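/- Let $n\ge 1$, $d=2^n$, and let $X_i,Y_i,Z_i$ be the Pauli operators on the $i$-th of $n$ qubits. Let $c_{2i-1}=Z_1\cdots Z_{i-1}X_i$ and $c_{2i}=Z_1\cdots Z_{i-1}Y_i$ ($1\le i\le n$) be the Majorana operators, $d_i=\tfrac12(c_{2i-1}+i\,c_{2i})$ the Dirac operators, and $P=Z^{\otimes n}$ the parity. Let $\mathfrak g$ be the real Lie algebra generated, under the commutator, by $iH$ for $H\in\mathcal G=\{Z_1,\dots,Z_n\}\cup\{X_1X_2,\dots,X_{n-1}X_n\}$, and $G=e^{\mathfrak g}\subset U(2^n)$ the group generated by the exponentials of its elements. For an operator $M$, let $\mathcal P_{\mathfrak g}(M)=\mathrm{Tr}[M_{\mathfrak g}^\dagger M_{\mathfrak g}]$, where $M_{\mathfrak g}$ is the orthogonal projection of $M$ (for the Hilbert--Schmidt inner product) onto $\mathrm{span}_{\mathbb C}\,\mathfrak g$. Let $\rho$ be a fermionic state, i.e. a density matrix on $(\mathbb C^2)^{\otimes n}$ with $[\rho,P]=0$. Put $\langle A\rangle=\mathrm{Tr}[\rho A]$, $\gamma=(d_1,\dots,d_n,d_1^\dagger,\dots,d_n^\dagger)^t$,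 let $D=\mathbf 1-\langle\gamma\gamma^\dagger\rangle$ be the $2n\times 2n$ extended one-body density matrix, and let $S_2(\rho)=2\,\mathrm{Tr}[D(\mathbf 1-D)]$ be its linear entropy. (1) The $\mathfrak g$-purity of $\rho$ coincides with its $2$-purity, that is, with $\mathrm{Tr}[\rho_2^\dagger\rho_2]$, where $\rho_2$ is the orthogonal projection of $\rho$ onto $\mathcal B_2=\mathrm{span}_{\mathbb C}\{c_\mu c_\nu\}_{\mu\ne\nu}$, and $$\mathcal P_{\mathfrak g}(\rho)=\frac{2\,\mathrm{Tr}[D^2]-n}{2^n}=\frac{n-S_2(\rho)}{2^n}.$$ (2) Let $n\ge 2$ and let $O\in i\mathfrak g$ with $\mathrm{Tr}[O^2]=2^n$; if $n=2$, assume moreover that $O$ is, up to a sign, a Pauli string. For a unitary $U$ put $\ell_U(\rho,O)=\mathrm{Tr}[U\rho U^\dagger O]$. Then $$\mathbb E[\ell_U(\rho,O)^2]-\mathbb E[\ell_U(\rho,O)]^2=\frac{n-S_2(\rho)}{\dim_{\mathbb R}\mathfrak g},$$ both when $U$ is distributed according to the normalized Haar measure on $G$, and when $U=U(\vec\theta)=\prod_{l=1}^{L}e^{-i\theta_lH_l}$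 is a parametrized circuit with $H_l\in\mathcal G$ and random parameters $\vec\theta\in\mathbb R^L$ that is a $2$-design over $G$, i.e. $\mathbb E_{\vec\theta}[U(\vec\theta)^{\otimes t}AU(\vec\theta)^{\dagger\otimes t}]=\int_G dU\,U^{\otimes t}AU^{\dagger\otimes t}$ for $t=1,2$ and all $A$. -/

import Mathlib

open MeasureTheory Matrix
open scoped Kronecker ComplexOrder

noncomputable section

namespace Matchgate

/-! ### Qubits, Pauli strings -/

/-- Linear operators on `(ℂ²)^{⊗ n}`, as matrices in the computational basis `Fin n → Fin 2`. -/
abbrev Op (n : ℕ) : Type := Matrix (Fin n → Fin 2) (Fin n → Fin 2) ℂ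

def pauliX : Matrix (Fin 2) (Fin 2) ℂ := !![0, 1; 1, 0]

def pauliY : Matrix (Fin 2) (Fin 2) ℂ := !![0, -Complex.I; Complex.I, 0]

def pauliZ : Matrix (Fin 2) (Fin 2) ℂ := !![1, 0; 0, -1]

/-- The tensor product `A 0 ⊗ ⋯ ⊗ A (n-1)` of one-qubit operators. -/
def tensorOp {n : ℕ} (A : Fin n → Matrix (Fin 2) (Fin 2) ℂ) : Op n :=
  Matrix.of fun x y => ∏ j, A j (x j) (y j)

/-- `O` is, up to a sign, a Pauli string. -/
def IsPauli {n : ℕ} (O : Op n) : Prop :=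
  ∃ A : Fin n → Matrix (Fin 2) (Fin 2) ℂ,
    (∀ j, A j = 1 ∨ A j = pauliX ∨ A j = pauliY ∨ A j = pauliZ) ∧
      (O = tensorOp A ∨ O = -tensorOp A)

/-- The Pauli `Z` on qubit `i`. -/
def siteZ {n : ℕ} (i : Fin n) : Op n :=
  tensorOp fun j => if j = i then pauliZ else 1

/-- `X ⊗ X` on the qubits `i` and `k` (used for `i ≠ k`). -/
def siteXX {n : ℕ} (i k : Fin n) : Op n :=
  tensorOp fun j => if j = i ∨ j = k then pauliX else 1

/-- The fermionic parity `P = Z^{⊗ n}`. -/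
def parity (n : ℕ) : Op n := tensorOp fun _ => pauliZ

/-! ### Majorana and Dirac operators -/

/-- The Majorana operators, indexed from zero: `majorana (2 i)` and `majorana (2 i + 1)` are
`Z ⋯ Z X 1 ⋯ 1` and `Z ⋯ Z Y 1 ⋯ 1` with `X`, `Y` on the qubit `i`. -/
def majorana {n : ℕ} (μ : Fin (2 * n)) : Op n :=
  tensorOp fun j =>
    if (j : ℕ) < (μ : ℕ) / 2 then pauliZ
    else if (j : ℕ) = (μ : ℕ) / 2 then (if (μ : ℕ) % 2 = 0 then pauliX else pauliY)
    else 1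

/-- The Dirac (annihilation) operators `d i = (c (2 i) + I c (2 i + 1)) / 2`. -/
def dirac {n : ℕ} (i : Fin n) : Op n :=
  (1 / 2 : ℂ) • (majorana ⟨2 * (i : ℕ), by omega⟩ +
    Complex.I • majorana ⟨2 * (i : ℕ) + 1, by omega⟩)

/-- The column `γ = (d, d†)`. -/
def gammaOp {n : ℕ} : Fin n ⊕ Fin n → Op n :=
  Sum.elim (fun i => dirac i) (fun i => (dirac i)ᴴ)

/-- The Dirac contraction matrix, or extended one-body density matrix,
`D = 1 - ⟨γ γ†⟩`, where `⟨A⟩ = Tr[ρ A]`. -/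
def extDensity {n : ℕ} (ρ : Op n) : Matrix (Fin n ⊕ Fin n) (Fin n ⊕ Fin n) ℂ :=
  1 - Matrix.of fun a b => (ρ * (gammaOp a * (gammaOp b)ᴴ)).trace

/-- The linear entropy `S₂ = 2 Tr[D (1 - D)]`. -/
def linEntropy {n : ℕ} (ρ : Op n) : ℂ :=
  2 * (extDensity ρ * (1 - extDensity ρ)).trace

/-! ### States -/

/-- Density matrices. -/
structure IsState {n : ℕ} (ρ : Op n) : Prop where
  posSemidef : ρ.PosSemidef
  trace_eq_one : ρ.trace = 1

/-- Fermionic states: the states that commute with the parity. -/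
structure IsFermionicState {n : ℕ} (ρ : Op n) : Prop extends IsState ρ where
  commute_parity : Commute ρ (parity n)

/-! ### The dynamical Lie algebra and its group -/

/-- The circuit generators: all `Z_i` and all `X_i X_{i+1}`. -/
def generators (n : ℕ) : Set (Op n) :=
  {H | (∃ i : Fin n, H = siteZ i) ∨
    ∃ i k : Fin n, (k : ℕ) = (i : ℕ) + 1 ∧ H = siteXX i k}

/-- Operators form a Lie ring under the commutator. -/
instance opLieRing (n : ℕ) : LieRing (Op n) := LieRing.ofAssociativeRing

/-- The dynamical Lie algebra `𝔤`: the real Lie algebra generated by `I • H`, `H` a generator. -/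
def dla (n : ℕ) : LieSubalgebra ℝ (Op n) :=
  LieSubalgebra.lieSpan ℝ (Op n) {A | ∃ H ∈ generators n, A = Complex.I • H}

/-- The group `G = e^𝔤`, as the subgroup of the unitary group generated by the exponentials
of elements of `𝔤`. -/
def group (n : ℕ) : Subgroup (Matrix.unitaryGroup (Fin n → Fin 2) ℂ) :=
  Subgroup.closure {u | ∃ A ∈ dla n, (u : Op n) = NormedSpace.exp A}

instance groupMeasurableSpace (n : ℕ) : MeasurableSpace (group n) := borel _

instance groupBorelSpace (n : ℕ) : BorelSpace (group n) := ⟨rfl⟩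

/-! ### Hilbert–Schmidt projections and purities -/

/-- A matrix as a vector of the Hilbert space with inner product `Tr[A† B]`. -/
def hsVec (n : ℕ) : Op n ≃ₗ[ℂ] EuclideanSpace ℂ ((Fin n → Fin 2) × (Fin n → Fin 2)) :=
  (LinearEquiv.curry ℂ ℂ (Fin n → Fin 2) (Fin n → Fin 2)).symm ≪≫ₗ
    (WithLp.linearEquiv 2 ℂ ((Fin n → Fin 2) × (Fin n → Fin 2) → ℂ)).symm

theorem inner_hsVec {n : ℕ} (A B : Op n) :
    inner ℂ (hsVec n A) (hsVec n B) = (Aᴴ * B).trace := by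
  rw [PiLp.inner_apply, Fintype.sum_prod_type, Finset.sum_comm]
  simp only [Matrix.trace, Matrix.diag, Matrix.mul_apply, Matrix.conjTranspose_apply]
  refine Finset.sum_congr rfl fun y _ => Finset.sum_congr rfl fun x _ => ?_
  have h : ∀ M : Op n, hsVec n M (x, y) = M x y := fun _ => rfl
  simp [h, mul_comm]

/-- The orthogonal projection of `M` onto `V` for the Hilbert–Schmidt inner product. -/
def hsProj {n : ℕ} (V : Submodule ℂ (Op n)) (M : Op n) : Op n :=
  (hsVec n).symm ((V.map (hsVec n).toLinearMap).starProjection (hsVec n M))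

/-- The purity `Tr[M_V† M_V]` of the component `M_V` of `M` in `V`. -/
def purity {n : ℕ} (V : Submodule ℂ (Op n)) (M : Op n) : ℂ :=
  ((hsProj V M)ᴴ * hsProj V M).trace

/-- The module `𝓑_κ`, spanned by the products of `κ` distinct Majorana operators. -/
def majoranaModule (n κ : ℕ) : Submodule ℂ (Op n) :=
  Submodule.span ℂ {B | ∃ f : Fin κ → Fin (2 * n), Function.Injective f ∧
    B = (List.ofFn fun j => majorana (f j)).prod}

/-- The `κ`-purity. -/
def kappaPurity {n : ℕ} (κ : ℕ) (M : Op n) : ℂ := purity (majoranaModule n κ) M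

/-- The `𝔤`-purity: the purity of the component in the complex span of `𝔤`. -/
def gPurity {n : ℕ} (M : Op n) : ℂ := purity (Submodule.span ℂ (dla n : Set (Op n))) M

/-! ### Circuits, losses, variances -/

/-- The loss `Tr[U ρ U† O]`. -/
def loss {n : ℕ} (U ρ O : Op n) : ℂ := (U * ρ * Uᴴ * O).trace

/-- The variance `E[ℓ²] - E[ℓ]²` of the loss for a random `U θ`, `θ ∼ ν`. -/
def lossVariance {n : ℕ} {Θ : Type*} [MeasurableSpace Θ] (ν : Measure Θ) (U : Θ → Op n)
    (ρ O : Op n) : ℂ :=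
  (∫ θ, loss (U θ) ρ O ^ 2 ∂ν) - (∫ θ, loss (U θ) ρ O ∂ν) ^ 2

/-- The parametrized circuit `U(θ) = ∏_l exp(-I θ_l H_l)`. -/
def circuit {n L : ℕ} (H : Fin L → Op n) (θ : Fin L → ℝ) : Op n :=
  (List.ofFn fun l => NormedSpace.exp (-(Complex.I * (θ l : ℂ)) • H l)).prod

/-- `E[U A U†]`, entry by entry. -/
def firstMoment {n : ℕ} {Θ : Type*} [MeasurableSpace Θ] (ν : Measure Θ) (U : Θ → Op n)
    (A : Op n) : Op n :=
  Matrix.of fun x y => ∫ θ, (U θ * A * (U θ)ᴴ) x y ∂ν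

/-- `E[U^{⊗ 2} A U†^{⊗ 2}]`, entry by entry. -/
def secondMoment {n : ℕ} {Θ : Type*} [MeasurableSpace Θ] (ν : Measure Θ) (U : Θ → Op n)
    (A : Matrix ((Fin n → Fin 2) × (Fin n → Fin 2)) ((Fin n → Fin 2) × (Fin n → Fin 2)) ℂ) :
    Matrix ((Fin n → Fin 2) × (Fin n → Fin 2)) ((Fin n → Fin 2) × (Fin n → Fin 2)) ℂ :=
  Matrix.of fun x y => ∫ θ, ((U θ ⊗ₖ U θ) * A * (U θ ⊗ₖ U θ)ᴴ) x y ∂ν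

/-- The inclusion of `G` in the operators. -/
def groupOp {n : ℕ} (u : group n) : Op n := ((u : Matrix.unitaryGroup (Fin n → Fin 2) ℂ) : Op n)

/-- The random operator `U θ`, `θ ∼ ν`, is a 2-design over `G` with Haar measure `μ`. -/
structure IsTwoDesign {n : ℕ} {Θ : Type*} [MeasurableSpace Θ] (ν : Measure Θ) (U : Θ → Op n)
    (μ : Measure (group n)) : Prop where
  first : ∀ A, firstMoment ν U A = firstMoment μ groupOp A
  second : ∀ A, secondMoment ν U A = secondMoment μ groupOp A

end Matchgate

end

/-! Everything is expressed in the quadratic products `majoranaPair p` $=c_\mu c_\nu$, $\mu<\nu$.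
They are anti-Hermitian, square to $-1$ and are orthogonal for the trace form, with
$\mathrm{Tr}[c_pc_q]=-2^n\delta_{pq}$. The generators times $i$ are exactly the products of
neighbouring Majoranas, and iterated commutators reach all the others, so the pairs form a real
basis of $\mathfrak g$ (`dla_toSubmodule`) and a complex basis of $\mathcal B_2$.

Purity: projecting onto this basis gives $\mathcal P_{\mathfrak
g}(\rho)=-2^{-n}\sum_p\mathrm{Tr}[c_p\rho]^2$. Write $\langle c_\mu
c_\nu\rangle=\delta_{\mu\nu}+K_{\mu\nu}$ with $K$ antisymmetric. Since $\gamma$ is $1/\sqrt2$ times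
a unitary image of the Majoranas, $D$ is unitarily equivalent to $\frac12(1-K)$. Hence
$2\,\mathrm{Tr}[D^2]-n=-\sum_p\mathrm{Tr}[c_p\rho]^2$ (`trace_extDensity_sq`), and
$\mathrm{Tr}\,D=n$ turns this into $n-S_2$.

Variance: conjugation by $G$ preserves the span of the pairs and its trace form, so it acts by
orthogonal matrices and $\sum_p\ell_U(\rho,c_p)^2$ does not depend on $U$
(`sum_loss_majoranaPair_sq`). Haar invariance under the elements $c_\alpha c_\beta\in G$, which act
on pairs by signs, kills the means and mixed second moments; invariance under quarter turns in the
plane of $c_\alpha,c_\beta$ makes all the second moments equal (`integral_loss_sq_eq`). Each is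
therefore the constant sum divided by $\dim\mathfrak g$, and $\mathrm{Tr}[O^2]=2^n$ fixes the sum of
squared coefficients of $O$.

The sign argument fails only for $n=2$ and complementary pairs such as $c_1c_2$, $c_3c_4$,
reflecting the splitting of $\mathfrak{so}(4)$. A Pauli string never has both of two such pairs in
its expansion (`coeff_mul_integral_eq_zero`). For a 2-design, $\ell$ and $\ell^2$ are linear
functionals of the first two moment operators, so the Haar value carries over. -/

namespace Matchgate

/-! ### Tensor products of one-qubit operators -/

theorem tensorOp_mul {n : ℕ} (A B : Fin n → Matrix (Fin 2) (Fin 2) ℂ) :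
    tensorOp A * tensorOp B = tensorOp fun j => A j * B j := by
  ext x y
  simp only [tensorOp, Matrix.mul_apply, Matrix.of_apply, ← Finset.prod_mul_distrib]
  rw [Finset.prod_univ_sum, Fintype.piFinset_univ]

theorem tensorOp_smul {n : ℕ} (s : Fin n → ℂ) (A : Fin n → Matrix (Fin 2) (Fin 2) ℂ) :
    tensorOp (fun j => s j • A j) = (∏ j, s j) • tensorOp A := by
  ext x y
  simp [tensorOp, Finset.prod_mul_distrib]

theorem tensorOp_one {n : ℕ} : tensorOp (fun _ : Fin n => 1) = 1 := by
  ext x y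
  simp only [tensorOp, Matrix.of_apply, Matrix.one_apply, Finset.prod_ite_zero,
    Finset.prod_const_one, Finset.mem_univ, true_imp_iff, funext_iff]

theorem tensorOp_conjTranspose {n : ℕ} (A : Fin n → Matrix (Fin 2) (Fin 2) ℂ) :
    (tensorOp A)ᴴ = tensorOp fun j => (A j)ᴴ := by
  ext x y
  simp [tensorOp, Matrix.conjTranspose_apply]

theorem tensorOp_mul_comm_smul {n : ℕ} {A B : Fin n → Matrix (Fin 2) (Fin 2) ℂ} (s : Fin n → ℂ)
    (h : ∀ j, A j * B j = s j • (B j * A j)) :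
    tensorOp A * tensorOp B = (∏ j, s j) • (tensorOp B * tensorOp A) := by
  rw [tensorOp_mul, tensorOp_mul, ← tensorOp_smul]
  exact congrArg tensorOp (funext h)

/-! ### One-qubit Pauli matrices -/

theorem pauliX_mul_self : pauliX * pauliX = 1 := by
  ext i j; fin_cases i <;> fin_cases j <;> simp [pauliX]

theorem pauliY_mul_self : pauliY * pauliY = 1 := by
  ext i j; fin_cases i <;> fin_cases j <;> simp [pauliY]

theorem pauliZ_mul_self : pauliZ * pauliZ = 1 := by
  ext i j; fin_cases i <;> fin_cases j <;> simp [pauliZ]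

theorem pauliX_mul_pauliY : pauliX * pauliY = Complex.I • pauliZ := by
  ext i j; fin_cases i <;> fin_cases j <;> simp [pauliX, pauliY, pauliZ]

theorem pauliY_mul_pauliX : pauliY * pauliX = -(Complex.I • pauliZ) := by
  ext i j; fin_cases i <;> fin_cases j <;> simp [pauliX, pauliY, pauliZ]

theorem pauliY_mul_pauliZ : pauliY * pauliZ = Complex.I • pauliX := by
  ext i j; fin_cases i <;> fin_cases j <;> simp [pauliX, pauliY, pauliZ]

theorem pauliZ_mul_pauliY : pauliZ * pauliY = -(Complex.I • pauliX) := by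
  ext i j; fin_cases i <;> fin_cases j <;> simp [pauliX, pauliY, pauliZ]

theorem pauliZ_mul_pauliX : pauliZ * pauliX = Complex.I • pauliY := by
  ext i j; fin_cases i <;> fin_cases j <;> simp [pauliX, pauliY, pauliZ]

theorem pauliX_mul_pauliZ : pauliX * pauliZ = -(Complex.I • pauliY) := by
  ext i j; fin_cases i <;> fin_cases j <;> simp [pauliX, pauliY, pauliZ]

theorem pauliX_conjTranspose : pauliXᴴ = pauliX := by
  ext i j; fin_cases i <;> fin_cases j <;> simp [pauliX]

theorem pauliY_conjTranspose : pauliYᴴ = pauliY := by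
  ext i j; fin_cases i <;> fin_cases j <;> simp [pauliY]

theorem pauliZ_conjTranspose : pauliZᴴ = pauliZ := by
  ext i j; fin_cases i <;> fin_cases j <;> simp [pauliZ]

/-- The one-qubit Pauli matrices and the identity. -/
def IsPauliMatrix (A : Matrix (Fin 2) (Fin 2) ℂ) : Prop :=
  A = 1 ∨ A = pauliX ∨ A = pauliY ∨ A = pauliZ

theorem IsPauliMatrix.mul_self {A : Matrix (Fin 2) (Fin 2) ℂ} (hA : IsPauliMatrix A) :
    A * A = 1 := by
  rcases hA with rfl | rfl | rfl | rfl <;>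
    simp [pauliX_mul_self, pauliY_mul_self, pauliZ_mul_self]

theorem IsPauliMatrix.conjTranspose {A : Matrix (Fin 2) (Fin 2) ℂ} (hA : IsPauliMatrix A) :
    Aᴴ = A := by
  rcases hA with rfl | rfl | rfl | rfl <;>
    simp [pauliX_conjTranspose, pauliY_conjTranspose, pauliZ_conjTranspose]

theorem IsPauliMatrix.mul_comm_or {A B : Matrix (Fin 2) (Fin 2) ℂ} (hA : IsPauliMatrix A)
    (hB : IsPauliMatrix B) : A * B = B * A ∨ A * B = -(B * A) := by
  rcases hA with rfl | rfl | rfl | rfl <;> rcases hB with rfl | rfl | rfl | rfl <;>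
    simp [pauliX_mul_pauliY, pauliY_mul_pauliX, pauliY_mul_pauliZ, pauliZ_mul_pauliY,
      pauliZ_mul_pauliX, pauliX_mul_pauliZ]

theorem tensorOp_mul_comm_or {n : ℕ} {A B : Fin n → Matrix (Fin 2) (Fin 2) ℂ}
    (hA : ∀ j, IsPauliMatrix (A j)) (hB : ∀ j, IsPauliMatrix (B j)) :
    tensorOp A * tensorOp B = tensorOp B * tensorOp A ∨
      tensorOp A * tensorOp B = -(tensorOp B * tensorOp A) := by
  have h : ∀ j, ∃ s : ℂ, (s = 1 ∨ s = -1) ∧ A j * B j = s • (B j * A j) := fun j => by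
    rcases (hA j).mul_comm_or (hB j) with h | h
    · exact ⟨1, Or.inl rfl, by simpa using h⟩
    · exact ⟨-1, Or.inr rfl, by simpa using h⟩
  choose s hs h using h
  have hp : (∏ j, s j) = 1 ∨ (∏ j, s j) = -1 :=
    Finset.prod_induction s (fun z => z = 1 ∨ z = -1)
      (by rintro _ _ (rfl | rfl) (rfl | rfl) <;> simp) (Or.inl rfl) (fun j _ => hs j)
  rw [tensorOp_mul_comm_smul s h]
  rcases hp with hp | hp <;> simp [hp]

theorem tensorOp_mul_self {n : ℕ} {A : Fin n → Matrix (Fin 2) (Fin 2) ℂ}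
    (hA : ∀ j, IsPauliMatrix (A j)) : tensorOp A * tensorOp A = 1 := by
  rw [tensorOp_mul, ← tensorOp_one]
  exact congrArg tensorOp (funext fun j => (hA j).mul_self)

theorem tensorOp_isHermitian {n : ℕ} {A : Fin n → Matrix (Fin 2) (Fin 2) ℂ}
    (hA : ∀ j, IsPauliMatrix (A j)) : (tensorOp A)ᴴ = tensorOp A := by
  rw [tensorOp_conjTranspose]
  exact congrArg tensorOp (funext fun j => (hA j).conjTranspose)

theorem generators_isHermitian {n : ℕ} {H : Op n} (hH : H ∈ generators n) : Hᴴ = H := by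
  rcases hH with ⟨i, rfl⟩ | ⟨i, k, -, rfl⟩
  · refine tensorOp_isHermitian fun j => ?_
    by_cases h : j = i <;> simp [h, IsPauliMatrix]
  · refine tensorOp_isHermitian fun j => ?_
    by_cases h : j = i ∨ j = k <;> simp [h, IsPauliMatrix]

/-! ### The canonical anticommutation relations -/

theorem majorana_site_isPauliMatrix (μ j : ℕ) :
    IsPauliMatrix (if j < μ / 2 then pauliZ
      else if j = μ / 2 then (if μ % 2 = 0 then pauliX else pauliY) else 1) := by
  split_ifs <;> simp [IsPauliMatrix]

theorem majorana_mul_self {n : ℕ} (μ : Fin (2 * n)) :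
    (majorana μ : Op n) * majorana μ = 1 :=
  tensorOp_mul_self fun _ => majorana_site_isPauliMatrix _ _

theorem majorana_conjTranspose {n : ℕ} (μ : Fin (2 * n)) :
    (majorana μ : Op n)ᴴ = majorana μ :=
  tensorOp_isHermitian fun _ => majorana_site_isPauliMatrix _ _

theorem IsPauli.mul_majorana {n : ℕ} {O : Op n} (hO : IsPauli O) (μ : Fin (2 * n)) :
    O * majorana μ = majorana μ * O ∨ O * majorana μ = -(majorana μ * O) := by
  obtain ⟨A, hA, hO⟩ := hO
  have h := tensorOp_mul_comm_or (A := A) hA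
    (fun j : Fin n => majorana_site_isPauliMatrix μ j)
  change tensorOp A * majorana μ = majorana μ * tensorOp A ∨
    tensorOp A * majorana μ = -(majorana μ * tensorOp A) at h
  rcases hO with rfl | rfl
  · exact h
  · rw [neg_mul, mul_neg]
    exact h.imp (congrArg Neg.neg) (congrArg Neg.neg)

/-- The two strings commute at every site except `μ / 2`. Before it both carry $Z$, after it the
first is the identity, and at it $X$ or $Y$ meets $Z$, or $X$ meets $Y$ when the site is shared. -/
theorem majorana_anticomm_of_lt {n : ℕ} {μ ν : Fin (2 * n)} (h : μ < ν) :
    (majorana μ : Op n) * majorana ν = -(majorana ν * majorana μ) := by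
  have hlt : (μ : ℕ) < ν := h
  have hμ : (μ : ℕ) / 2 < n := by omega
  have key := tensorOp_mul_comm_smul
    (A := fun j : Fin n => if (j : ℕ) < (μ : ℕ) / 2 then pauliZ
      else if (j : ℕ) = (μ : ℕ) / 2 then (if (μ : ℕ) % 2 = 0 then pauliX else pauliY) else 1)
    (B := fun j : Fin n => if (j : ℕ) < (ν : ℕ) / 2 then pauliZ
      else if (j : ℕ) = (ν : ℕ) / 2 then (if (ν : ℕ) % 2 = 0 then pauliX else pauliY) else 1)
    (fun j => if j = ⟨(μ : ℕ) / 2, hμ⟩ then -1 else 1) ?_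
  · rw [Finset.prod_ite_eq' Finset.univ, if_pos (Finset.mem_univ _), neg_one_smul] at key
    exact key
  · intro j
    simp only [Fin.ext_iff]
    rcases lt_trichotomy (j : ℕ) ((μ : ℕ) / 2) with hj | hj | hj
    · have h1 : (j : ℕ) < (ν : ℕ) / 2 := by omega
      simp [hj, h1, hj.ne]
    · by_cases h1 : (μ : ℕ) / 2 < (ν : ℕ) / 2
      · simp only [hj, lt_irrefl, if_false, if_true, h1]
        split_ifs <;> simp [pauliX_mul_pauliZ, pauliZ_mul_pauliX, pauliY_mul_pauliZ,
          pauliZ_mul_pauliY]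
      · have h2 : (ν : ℕ) / 2 = (μ : ℕ) / 2 := by omega
        have h3 : (μ : ℕ) % 2 = 0 := by omega
        have h4 : (ν : ℕ) % 2 = 1 := by omega
        simp [hj, h2, h3, h4, pauliX_mul_pauliY, pauliY_mul_pauliX]
    · have h1 : ¬ (j : ℕ) < (μ : ℕ) / 2 := by omega
      simp only [h1, hj.ne', if_false, one_smul, one_mul, mul_one]

theorem majorana_anticomm {n : ℕ} {μ ν : Fin (2 * n)} (h : μ ≠ ν) :
    (majorana μ : Op n) * majorana ν = -(majorana ν * majorana μ) := by
  rcases lt_or_gt_of_ne h with h | h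
  · exact majorana_anticomm_of_lt h
  · rw [majorana_anticomm_of_lt h, neg_neg]

/-! ### The generators as products of neighbouring Majorana operators -/

theorem majorana_mul_majorana_siteZ {n : ℕ} (i : Fin n) :
    (majorana ⟨2 * (i : ℕ), by omega⟩ : Op n) * majorana ⟨2 * (i : ℕ) + 1, by omega⟩ =
      Complex.I • siteZ i := by
  -- The scalar is absorbed into the factor at site `i`, which reduces the identity to one check per
  -- site.
  have hs : Complex.I • siteZ i = tensorOp fun j : Fin n =>
      (if j = i then Complex.I else 1) • (if j = i then pauliZ else 1) := by
    rw [tensorOp_smul, Finset.prod_ite_eq' Finset.univ]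
    simp [siteZ]
  rw [hs, majorana, majorana, tensorOp_mul]
  refine congrArg tensorOp (funext fun j => ?_)
  have h1 : 2 * (i : ℕ) / 2 = i := by omega
  have h2 : (2 * (i : ℕ) + 1) / 2 = i := by omega
  have h3 : (2 * (i : ℕ) + 1) % 2 = 1 := by omega
  simp only [h1, h2, h3, Fin.ext_iff]
  rcases lt_trichotomy (j : ℕ) i with hj | hj | hj
  · simp [hj, hj.ne, pauliZ_mul_self]
  · simp [hj, pauliX_mul_pauliY]
  · have h4 : ¬ (j : ℕ) < i := by omega
    simp [hj.ne', h4]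

theorem majorana_mul_majorana_siteXX {n : ℕ} {i k : Fin n} (hk : (k : ℕ) = i + 1) :
    (majorana ⟨2 * (i : ℕ) + 1, by omega⟩ : Op n) * majorana ⟨2 * (i : ℕ) + 2, by omega⟩ =
      Complex.I • siteXX i k := by
  have hs : Complex.I • siteXX i k = tensorOp fun j : Fin n =>
      (if j = i then Complex.I else 1) • (if j = i ∨ j = k then pauliX else 1) := by
    rw [tensorOp_smul, Finset.prod_ite_eq' Finset.univ]
    simp [siteXX]
  rw [hs, majorana, majorana, tensorOp_mul]
  refine congrArg tensorOp (funext fun j => ?_)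
  have h1 : (2 * (i : ℕ) + 1) / 2 = i := by omega
  have h2 : (2 * (i : ℕ) + 2) / 2 = i + 1 := by omega
  have h3 : (2 * (i : ℕ) + 2) % 2 = 0 := by omega
  have h4 : (2 * (i : ℕ) + 1) % 2 = 1 := by omega
  simp only [h1, h2, h3, h4, Fin.ext_iff, hk]
  rcases lt_trichotomy (j : ℕ) i with hj | hj | hj
  · have h5 : (j : ℕ) < i + 1 := by omega
    have h6 : (j : ℕ) ≠ i + 1 := by omega
    simp [hj, hj.ne, h5, h6, pauliZ_mul_self]
  · simp [hj, pauliY_mul_pauliZ]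
  · have h5 : ¬ (j : ℕ) < i + 1 := by omega
    have h6 : ¬ (j : ℕ) < i := by omega
    simp [hj.ne', h5, h6]

theorem exists_generator_of_consecutive {n : ℕ} (m : ℕ) (h : m + 1 < 2 * n) :
    ∃ H ∈ generators n,
      (majorana ⟨m, by omega⟩ : Op n) * majorana ⟨m + 1, h⟩ = Complex.I • H := by
  obtain ⟨k, rfl | rfl⟩ := Nat.even_or_odd' m
  · exact ⟨_, Or.inl ⟨⟨k, by omega⟩, rfl⟩, majorana_mul_majorana_siteZ ⟨k, by omega⟩⟩
  · exact ⟨_, Or.inr ⟨⟨k, by omega⟩, ⟨k + 1, by omega⟩, rfl, rfl⟩,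
      majorana_mul_majorana_siteXX (i := ⟨k, by omega⟩) (k := ⟨k + 1, by omega⟩) rfl⟩

/-! ### Products of two Majorana operators -/

theorem majorana_mul_cancel {n : ℕ} (μ : Fin (2 * n)) (A : Op n) :
    majorana μ * (majorana μ * A) = A := by
  rw [← mul_assoc, majorana_mul_self, one_mul]

theorem majorana_pair_anticomm {n : ℕ} {α μ ν : Fin (2 * n)} (h : μ ≠ ν) (hα : α = μ ∨ α = ν) :
    (majorana α : Op n) * (majorana μ * majorana ν) = -(majorana μ * majorana ν * majorana α) := by
  rcases hα with rfl | rfl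
  · rw [mul_assoc, majorana_anticomm h.symm, mul_neg, neg_neg]
  · rw [← mul_assoc, majorana_anticomm h.symm, neg_mul]

theorem majorana_pair_comm {n : ℕ} {α μ ν : Fin (2 * n)} (hμ : α ≠ μ) (hν : α ≠ ν) :
    (majorana α : Op n) * (majorana μ * majorana ν) = majorana μ * majorana ν * majorana α := by
  rw [← mul_assoc, majorana_anticomm hμ, neg_mul, mul_assoc, majorana_anticomm hν, mul_neg,
    neg_neg, mul_assoc]

theorem majorana_pair_conjTranspose {n : ℕ} {μ ν : Fin (2 * n)} (h : μ ≠ ν) :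
    ((majorana μ : Op n) * majorana ν)ᴴ = -(majorana μ * majorana ν) := by
  rw [conjTranspose_mul, majorana_conjTranspose, majorana_conjTranspose, majorana_anticomm h.symm]

theorem majorana_pair_sq {n : ℕ} {μ ν : Fin (2 * n)} (h : μ ≠ ν) :
    (majorana μ : Op n) * majorana ν * (majorana μ * majorana ν) = -1 := by
  rw [mul_assoc, majorana_pair_anticomm h (Or.inr rfl), mul_neg, mul_assoc,
    majorana_mul_self, mul_one, majorana_mul_self]

/-- Since $A=c_\alpha c_\alpha A=-c_\alpha Ac_\alpha$, cyclicity gives $\mathrm{Tr}A=-\mathrm{Tr}A$.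
-/
theorem trace_eq_zero_of_majorana_anticomm {n : ℕ} {A : Op n} (α : Fin (2 * n))
    (h : majorana α * A = -(A * majorana α)) : A.trace = 0 := by
  have h1 : A.trace = -A.trace := by
    conv_lhs => rw [← majorana_mul_cancel α A, h, mul_neg, trace_neg, ← mul_assoc,
      trace_mul_comm, majorana_mul_cancel]
  exact self_eq_neg.mp h1

theorem trace_one_op (n : ℕ) : (1 : Op n).trace = 2 ^ n := by
  simp [trace_one]

/-- The ordered pairs of Majorana indices. -/
abbrev PairIndex (n : ℕ) : Type := {p : Fin (2 * n) × Fin (2 * n) // p.1 < p.2}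

/-- The products `c μ * c ν`, `μ < ν`. -/
noncomputable def majoranaPair {n : ℕ} (p : PairIndex n) : Op n := majorana p.1.1 * majorana p.1.2

theorem majoranaPair_conjTranspose {n : ℕ} (p : PairIndex n) :
    (majoranaPair p)ᴴ = -majoranaPair p :=
  majorana_pair_conjTranspose p.2.ne

/-- Distinct two-element sets are never nested. The Majorana at such an `α` anticommutes with one
pair and commutes with the other, which drives both the orthogonality of the pairs and the vanishing
of mixed moments. -/
theorem PairIndex.exists_mem_not_mem {n : ℕ} {p q : PairIndex n} (h : p ≠ q) :
    ∃ α, (α = p.1.1 ∨ α = p.1.2) ∧ α ≠ q.1.1 ∧ α ≠ q.1.2 := by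
  by_contra! hc
  have h1 := hc p.1.1 (Or.inl rfl)
  have h2 := hc p.1.2 (Or.inr rfl)
  have hp := p.2
  have hq := q.2
  apply h
  apply Subtype.ext
  apply Prod.ext
  · by_contra h3
    have h4 := h1 h3
    rcases eq_or_ne p.1.2 q.1.1 with h5 | h5
    · exact absurd (h5 ▸ h4 ▸ hp) hq.asymm
    · exact hp.ne (h4.trans (h2 h5).symm)
  · rcases eq_or_ne p.1.2 q.1.1 with h5 | h5
    · rcases eq_or_ne p.1.1 q.1.1 with h6 | h6
      · exact absurd (h6.trans h5.symm) hp.ne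
      · have h7 := h1 h6
        rw [h5, h7] at hp
        exact absurd hp hq.asymm
    · exact h2 h5

theorem trace_majoranaPair_mul {n : ℕ} (p q : PairIndex n) :
    (majoranaPair p * majoranaPair q).trace = if p = q then -2 ^ n else 0 := by
  split_ifs with h
  · rw [h, majoranaPair, majorana_pair_sq q.2.ne, trace_neg, trace_one_op]
  · obtain ⟨α, hp, hq1, hq2⟩ := PairIndex.exists_mem_not_mem h
    apply trace_eq_zero_of_majorana_anticomm α
    rw [majoranaPair, majoranaPair, ← mul_assoc, majorana_pair_anticomm p.2.ne hp, neg_mul,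
      mul_assoc _ (majorana α), majorana_pair_comm hq1 hq2]
    simp only [mul_assoc]

/-! ### The dynamical Lie algebra -/

theorem majorana_pair_mem_span {n : ℕ} (R : Type*) [Ring R] [Module R (Op n)]
    {μ ν : Fin (2 * n)} (h : μ ≠ ν) :
    (majorana μ : Op n) * majorana ν ∈ Submodule.span R (Set.range (majoranaPair (n := n))) := by
  rcases lt_or_gt_of_ne h with h | h
  · exact Submodule.subset_span ⟨⟨(μ, ν), h⟩, rfl⟩
  · rw [majorana_anticomm h.ne']
    exact neg_mem (Submodule.subset_span ⟨⟨(ν, μ), h⟩, rfl⟩)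

theorem majorana_pair_lie {n : ℕ} {μ ν κ : Fin (2 * n)} (h1 : μ ≠ ν) (h2 : ν ≠ κ) (h3 : μ ≠ κ) :
    (majorana μ : Op n) * majorana ν * (majorana ν * majorana κ) -
      majorana ν * majorana κ * (majorana μ * majorana ν) =
    (2 : ℝ) • (majorana μ * majorana κ) := by
  have e1 : (majorana μ : Op n) * majorana ν * (majorana ν * majorana κ) =
      majorana μ * majorana κ := by rw [mul_assoc, majorana_mul_cancel]
  have e2 : (majorana ν : Op n) * majorana κ * (majorana μ * majorana ν) =
      -(majorana μ * majorana κ) := by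
    rw [mul_assoc, ← mul_assoc (majorana κ), ← mul_assoc, majorana_pair_comm h2 h1.symm,
      mul_assoc, majorana_mul_self, mul_one, majorana_anticomm h3.symm]
  rw [e1, e2, sub_neg_eq_add, two_smul]

theorem majorana_pair_commutator_mem {n : ℕ} {μ ν κ l : Fin (2 * n)} (h : μ ≠ ν) (h' : κ ≠ l) :
    (majorana μ : Op n) * majorana ν * (majorana κ * majorana l) -
      majorana κ * majorana l * (majorana μ * majorana ν) ∈
    Submodule.span ℝ (Set.range (majoranaPair (n := n))) := by
  -- The model case: one shared index, in the inner position. Anticommutation brings every other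
  -- pattern with exactly one shared index to this one; pairs with no common index, or equal up to
  -- order, commute.
  have key : ∀ {a b c : Fin (2 * n)}, a ≠ b → b ≠ c → a ≠ c →
      (majorana a : Op n) * majorana b * (majorana b * majorana c) -
        majorana b * majorana c * (majorana a * majorana b) ∈
      Submodule.span ℝ (Set.range (majoranaPair (n := n))) := fun h1 h2 h3 => by
    rw [majorana_pair_lie h1 h2 h3]
    exact Submodule.smul_mem _ _ (majorana_pair_mem_span ℝ h3)
  by_cases h1 : μ = κ
  · subst h1
    by_cases h2 : ν = l
    · subst h2; simp
    · have := neg_mem (key h.symm h' h2)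
      rw [majorana_anticomm h]
      convert this using 1
      noncomm_ring
  by_cases h2 : μ = l
  · subst h2
    by_cases h3 : ν = κ
    · subst h3; rw [majorana_anticomm h']; simp
    · rw [majorana_anticomm h, majorana_anticomm h']
      have := key h.symm h1 h3
      convert this using 1
      noncomm_ring
  by_cases h3 : ν = κ
  · subst h3; exact key h h' h2
  by_cases h4 : ν = l
  · subst h4
    have := neg_mem (key h h'.symm h1)
    rw [majorana_anticomm h']
    convert this using 1
    noncomm_ring
  · have : (majorana μ : Op n) * majorana ν * (majorana κ * majorana l) =
        majorana κ * majorana l * (majorana μ * majorana ν) := by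
      rw [mul_assoc, majorana_pair_comm h3 h4, ← mul_assoc, majorana_pair_comm h1 h2, mul_assoc]
    rw [this, sub_self]
    exact zero_mem _

/-- The real span of the products `c μ * c ν`, as a Lie algebra. -/
noncomputable def majoranaPairLie (n : ℕ) : LieSubalgebra ℝ (Op n) :=
  { Submodule.span ℝ (Set.range (majoranaPair (n := n))) with
    lie_mem' := by
      intro x y hx hy
      change x * y - y * x ∈ Submodule.span ℝ (Set.range (majoranaPair (n := n)))
      refine Submodule.span_induction₂ (p := fun x y _ _ =>
        x * y - y * x ∈ Submodule.span ℝ (Set.range (majoranaPair (n := n))))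
        ?_ ?_ ?_ ?_ ?_ ?_ ?_ hx hy
      · rintro _ _ ⟨p, rfl⟩ ⟨q, rfl⟩
        exact majorana_pair_commutator_mem p.2.ne q.2.ne
      · intro y _; simp
      · intro x _; simp
      · intro x y z _ _ _ h1 h2
        convert add_mem h1 h2 using 1; noncomm_ring
      · intro x y z _ _ _ h1 h2
        convert add_mem h1 h2 using 1; noncomm_ring
      · intro r x y _ _ h1
        convert Submodule.smul_mem _ r h1 using 1
        rw [smul_mul_assoc, mul_smul_comm, smul_sub]
      · intro r x y _ _ h1
        convert Submodule.smul_mem _ r h1 using 1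
        rw [smul_mul_assoc, mul_smul_comm, smul_sub] }

theorem majorana_consecutive_mem_dla {n : ℕ} (m : ℕ) (h : m + 1 < 2 * n) :
    (majorana ⟨m, by omega⟩ : Op n) * majorana ⟨m + 1, h⟩ ∈ dla n := by
  obtain ⟨H, hH, e⟩ := exists_generator_of_consecutive m h
  exact LieSubalgebra.subset_lieSpan ⟨H, hH, e⟩

/-- Induction on the gap: bracketing with the next neighbouring product lengthens it by one, up to
the factor 2 of `majorana_pair_lie`. -/
theorem majorana_pair_mem_dla_aux {n : ℕ} (m k : ℕ) (h : m + k + 1 < 2 * n) :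
    (majorana ⟨m, by omega⟩ : Op n) * majorana ⟨m + k + 1, h⟩ ∈ dla n := by
  induction k with
  | zero => exact majorana_consecutive_mem_dla m h
  | succ k ih =>
    have h1 := (dla n).lie_mem (ih (by omega)) (majorana_consecutive_mem_dla (m + k + 1) (by omega))
    have h2 := majorana_pair_lie (n := n) (μ := ⟨m, by omega⟩) (ν := ⟨m + k + 1, by omega⟩)
      (κ := ⟨m + k + 1 + 1, by omega⟩) (by simp; omega) (by simp) (by simp; omega)
    have h3 : (2 : ℝ) • ((majorana ⟨m, by omega⟩ : Op n) * majorana ⟨m + k + 1 + 1, by omega⟩) ∈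
        dla n := h2 ▸ h1
    have h4 := (dla n).smul_mem (2 : ℝ)⁻¹ h3
    rwa [smul_smul, inv_mul_cancel₀ two_ne_zero, one_smul] at h4

theorem majoranaPair_mem_dla {n : ℕ} (p : PairIndex n) : majoranaPair p ∈ dla n := by
  obtain ⟨⟨⟨m, hm⟩, ⟨k, hk⟩⟩, h⟩ := p
  obtain ⟨d, rfl⟩ : ∃ d, k = m + d + 1 := ⟨k - m - 1, by simp at h; omega⟩
  exact majorana_pair_mem_dla_aux m d hk

theorem dla_toSubmodule (n : ℕ) :
    (dla n).toSubmodule = Submodule.span ℝ (Set.range (majoranaPair (n := n))) := by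
  apply le_antisymm
  · have : dla n ≤ majoranaPairLie n := by
      refine LieSubalgebra.lieSpan_le.mpr ?_
      rintro _ ⟨H, hH, rfl⟩
      change Complex.I • H ∈ Submodule.span ℝ (Set.range (majoranaPair (n := n)))
      rcases hH with ⟨i, rfl⟩ | ⟨i, k, hk, rfl⟩
      · rw [← majorana_mul_majorana_siteZ]
        exact majorana_pair_mem_span ℝ (by simp)
      · rw [← majorana_mul_majorana_siteXX hk]
        exact majorana_pair_mem_span ℝ (by simp)
    exact this
  · rw [Submodule.span_le]
    rintro _ ⟨p, rfl⟩
    exact majoranaPair_mem_dla p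

theorem mem_dla_iff {n : ℕ} {A : Op n} :
    A ∈ dla n ↔ A ∈ Submodule.span ℝ (Set.range (majoranaPair (n := n))) := by
  rw [← dla_toSubmodule]; rfl

theorem exists_coeff_of_mem_dla {n : ℕ} {A : Op n} (hA : A ∈ dla n) :
    ∃ h : PairIndex n → ℝ, A = ∑ p, h p • majoranaPair p := by
  rw [mem_dla_iff, Submodule.mem_span_range_iff_exists_fun] at hA
  obtain ⟨h, hA⟩ := hA
  exact ⟨h, hA.symm⟩

theorem linearIndependent_majoranaPair (n : ℕ) :
    LinearIndependent ℝ (majoranaPair (n := n)) := by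
  rw [Fintype.linearIndependent_iff]
  intro g hg q
  have h := congrArg (fun A : Op n => (A * majoranaPair q).trace) hg
  simp only [Finset.sum_mul, trace_sum, smul_mul_assoc, trace_smul, trace_majoranaPair_mul,
    zero_mul, trace_zero, smul_ite, smul_zero] at h
  rw [Finset.sum_ite_eq' Finset.univ] at h
  simpa using h

theorem finrank_dla (n : ℕ) : Module.finrank ℝ (dla n) = Fintype.card (PairIndex n) := by
  change Module.finrank ℝ (dla n).toSubmodule = _
  rw [dla_toSubmodule, finrank_span_eq_card (linearIndependent_majoranaPair n)]

/-- The complex span of the products of two Majorana operators. -/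
noncomputable def pairSpan (n : ℕ) : Submodule ℂ (Op n) := Submodule.span ℂ (Set.range majoranaPair)

theorem span_dla (n : ℕ) : Submodule.span ℂ (dla n : Set (Op n)) = pairSpan n := by
  apply le_antisymm
  · rw [Submodule.span_le]
    intro A hA
    obtain ⟨h, rfl⟩ := exists_coeff_of_mem_dla hA
    refine sum_mem fun p _ => ?_
    rw [← Complex.coe_smul]
    exact Submodule.smul_mem _ _ (Submodule.subset_span ⟨p, rfl⟩)
  · refine Submodule.span_mono ?_
    rintro _ ⟨p, rfl⟩
    exact majoranaPair_mem_dla p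

theorem majoranaModule_two (n : ℕ) : majoranaModule n 2 = pairSpan n := by
  apply le_antisymm
  · refine Submodule.span_le.mpr ?_
    rintro _ ⟨f, hf, rfl⟩
    have : (List.ofFn fun j => (majorana (f j) : Op n)).prod =
        majorana (f 0) * majorana (f 1) := by simp [List.ofFn_succ]
    rw [this]
    exact majorana_pair_mem_span ℂ (fun h => absurd (hf h) (by simp))
  · refine Submodule.span_mono ?_
    rintro _ ⟨p, rfl⟩
    refine ⟨![p.1.1, p.1.2], ?_, by simp [List.ofFn_succ, majoranaPair]⟩
    intro i j hij
    have := p.2.ne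
    fin_cases i <;> fin_cases j <;> simp_all

/-! ### Purities -/

/-- The minus sign comes from $c_p^\dagger=-c_p$, and $2^n$ is the squared Hilbert–Schmidt norm of
$c_p$. -/
theorem hsProj_pairSpan {n : ℕ} (M : Op n) :
    hsProj (pairSpan n) M =
      -(2 ^ n : ℂ)⁻¹ • ∑ p, (majoranaPair p * M).trace • majoranaPair p := by
  rw [hsProj, LinearEquiv.symm_apply_eq]
  apply Submodule.eq_starProjection_of_mem_of_inner_eq_zero
  · refine Submodule.mem_map_of_mem (f := (hsVec n).toLinearMap) ?_
    refine Submodule.smul_mem _ _ (sum_mem fun p _ => Submodule.smul_mem _ _ ?_)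
    exact Submodule.subset_span ⟨p, rfl⟩
  · rintro _ ⟨B, hB, rfl⟩
    change inner ℂ _ (hsVec n B) = 0
    rw [← map_sub, inner_eq_zero_symm, inner_hsVec]
    refine Submodule.span_induction ?_ ?_ ?_ ?_ hB
    · rintro _ ⟨q, rfl⟩
      rw [majoranaPair_conjTranspose]
      simp only [neg_mul, trace_neg, mul_sub, trace_sub, mul_smul_comm, trace_smul,
        Finset.mul_sum, trace_sum, trace_majoranaPair_mul, smul_eq_mul, mul_neg, neg_neg,
        mul_ite, mul_zero]
      rw [Finset.sum_neg_distrib, Finset.sum_ite_eq Finset.univ, if_pos (Finset.mem_univ _)]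
      field_simp
      ring
    · simp
    · intro x y _ _ hx hy
      rw [conjTranspose_add, add_mul, trace_add, hx, hy, add_zero]
    · intro a x _ hx
      rw [conjTranspose_smul, smul_mul_assoc, trace_smul, hx, smul_zero]

/-- These traces are purely imaginary, so their squared moduli in the purity are minus their
squares. -/
theorem star_trace_majoranaPair_mul {n : ℕ} {M : Op n} (hM : Mᴴ = M) (p : PairIndex n) :
    star (majoranaPair p * M).trace = -(majoranaPair p * M).trace := by
  rw [← trace_conjTranspose, conjTranspose_mul, hM, majoranaPair_conjTranspose, mul_neg, trace_neg,
    trace_mul_comm]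

theorem purity_pairSpan {n : ℕ} {M : Op n} (hM : Mᴴ = M) :
    purity (pairSpan n) M = -(2 ^ n : ℂ)⁻¹ * ∑ p, (majoranaPair p * M).trace ^ 2 := by
  have h2 : (2 ^ n : ℂ) ≠ 0 := by positivity
  rw [purity, hsProj_pairSpan, conjTranspose_smul, smul_mul_smul_comm, trace_smul,
    conjTranspose_sum, Finset.sum_mul, trace_sum]
  have h : ∀ p : PairIndex n, (((majoranaPair p * M).trace • majoranaPair p)ᴴ *
      ∑ q, (majoranaPair q * M).trace • majoranaPair q).trace =
      -(2 ^ n) * (majoranaPair p * M).trace ^ 2 := fun p => by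
    rw [conjTranspose_smul, star_trace_majoranaPair_mul hM, majoranaPair_conjTranspose]
    simp only [Finset.mul_sum, trace_sum, smul_mul_smul_comm, neg_mul, trace_smul, trace_neg,
      trace_majoranaPair_mul, smul_eq_mul, mul_ite, mul_zero, mul_neg, neg_neg, smul_neg]
    rw [Finset.sum_neg_distrib, Finset.sum_ite_eq Finset.univ, if_pos (Finset.mem_univ _)]
    ring
  rw [Finset.sum_congr rfl fun p _ => h p, ← Finset.mul_sum]
  simp only [star_neg, star_inv₀, star_pow, smul_eq_mul, star_ofNat]
  field_simp

theorem gPurity_eq {n : ℕ} {M : Op n} (hM : Mᴴ = M) :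
    gPurity M = -(2 ^ n : ℂ)⁻¹ * ∑ p, (majoranaPair p * M).trace ^ 2 := by
  rw [gPurity, span_dla, purity_pairSpan hM]

theorem gPurity_eq_kappaPurity_two {n : ℕ} (M : Op n) : gPurity M = kappaPurity 2 M := by
  rw [gPurity, kappaPurity, span_dla, majoranaModule_two]

/-! ### The extended one-body density matrix -/

/-- The expectation value of `c μ * c ν`. -/
noncomputable def contraction {n : ℕ} (ρ : Op n) (μ ν : Fin (2 * n)) : ℂ :=
  (ρ * (majorana μ * majorana ν)).trace

theorem contraction_self {n : ℕ} {ρ : Op n} (hρ : ρ.trace = 1) (μ : Fin (2 * n)) :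
    contraction ρ μ μ = 1 := by
  rw [contraction, majorana_mul_self, mul_one, hρ]

theorem contraction_swap {n : ℕ} (ρ : Op n) {μ ν : Fin (2 * n)} (h : μ ≠ ν) :
    contraction ρ ν μ = -contraction ρ μ ν := by
  rw [contraction, majorana_anticomm h.symm, mul_neg, trace_neg, contraction]

/-- The even Majorana index of a mode. -/
def evenIdx {n : ℕ} (i : Fin n) : Fin (2 * n) := ⟨2 * (i : ℕ), by omega⟩

/-- The odd Majorana index of a mode. -/
def oddIdx {n : ℕ} (i : Fin n) : Fin (2 * n) := ⟨2 * (i : ℕ) + 1, by omega⟩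

theorem evenIdx_ne_oddIdx {n : ℕ} (i j : Fin n) : (evenIdx i : Fin (2 * n)) ≠ oddIdx j := by
  simp only [evenIdx, oddIdx, ne_eq, Fin.mk.injEq]; omega

theorem evenIdx_inj {n : ℕ} {i j : Fin n} : (evenIdx i : Fin (2 * n)) = evenIdx j ↔ i = j := by
  simp only [evenIdx, Fin.ext_iff]; omega

theorem oddIdx_inj {n : ℕ} {i j : Fin n} : (oddIdx i : Fin (2 * n)) = oddIdx j ↔ i = j := by
  simp only [oddIdx, Fin.ext_iff]; omega

theorem sum_evenIdx_oddIdx {n : ℕ} (F : Fin (2 * n) → ℂ) :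
    ∑ μ, F μ = ∑ i, F (evenIdx i) + ∑ i, F (oddIdx i) := by
  have hb : Function.Bijective
      (Sum.elim evenIdx oddIdx : Fin n ⊕ Fin n → Fin (2 * n)) := by
    constructor
    · rintro (i | i) (j | j) h
      · exact congrArg _ (evenIdx_inj.mp h)
      · exact absurd h (evenIdx_ne_oddIdx i j)
      · exact absurd h.symm (evenIdx_ne_oddIdx j i)
      · exact congrArg _ (oddIdx_inj.mp h)
    · rintro ⟨m, hm⟩
      obtain ⟨k, rfl | rfl⟩ := Nat.even_or_odd' m
      · exact ⟨Sum.inl ⟨k, by omega⟩, rfl⟩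
      · exact ⟨Sum.inr ⟨k, by omega⟩, rfl⟩
  rw [← (Equiv.ofBijective _ hb).sum_comp F, Fintype.sum_sum_type]
  rfl

theorem sum_pairIndex {n : ℕ} (F : Fin (2 * n) → Fin (2 * n) → ℂ)
    (hsymm : ∀ μ ν, F μ ν = F ν μ) (hdiag : ∀ μ, F μ μ = 0) :
    ∑ μ, ∑ ν, F μ ν = 2 * ∑ p : PairIndex n, F p.1.1 p.1.2 := by
  have h1 : ∑ p : PairIndex n, F p.1.1 p.1.2 = ∑ μ, ∑ ν, if μ < ν then F μ ν else 0 := by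
    rw [← Finset.sum_subtype (Finset.univ.filter fun p : Fin (2 * n) × Fin (2 * n) => p.1 < p.2)
      (by simp) (fun p => F p.1 p.2), Finset.sum_filter, Fintype.sum_prod_type]
  have h2 : ∑ μ, ∑ ν, (if μ < ν then F μ ν else 0) =
      ∑ μ, ∑ ν, if ν < μ then F μ ν else 0 := by
    rw [Finset.sum_comm]
    simp only [hsymm]
  suffices h3 : ∑ μ, ∑ ν, F μ ν = ∑ μ, ∑ ν, (if μ < ν then F μ ν else 0) +
      ∑ μ, ∑ ν, if ν < μ then F μ ν else 0 by
    rw [h1, h3, ← h2]; ring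
  simp only [← Finset.sum_add_distrib]
  refine Finset.sum_congr rfl fun μ _ => Finset.sum_congr rfl fun ν _ => ?_
  rcases lt_trichotomy μ ν with h | h | h
  · simp [h, h.asymm]
  · simp [h, hdiag]
  · simp [h, h.asymm]

theorem dirac_eq {n : ℕ} (i : Fin n) :
    (dirac i : Op n) = (1 / 2 : ℂ) • (majorana (evenIdx i) + Complex.I • majorana (oddIdx i)) :=
  rfl

theorem dirac_conjTranspose {n : ℕ} (i : Fin n) :
    (dirac i : Op n)ᴴ =
      (1 / 2 : ℂ) • (majorana (evenIdx i) - Complex.I • majorana (oddIdx i)) := by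
  rw [dirac_eq, conjTranspose_smul, conjTranspose_add, conjTranspose_smul, majorana_conjTranspose,
    majorana_conjTranspose]
  simp [sub_eq_add_neg]

theorem trace_mul_pair {n : ℕ} (ρ : Op n) (a b a' b' : ℂ) (μ ν κ l : Fin (2 * n)) :
    (ρ * ((a • majorana μ + b • majorana ν) * (a' • majorana κ + b' • majorana l))).trace =
      a * a' * contraction ρ μ κ + a * b' * contraction ρ μ l + b * a' * contraction ρ ν κ +
        b * b' * contraction ρ ν l := by
  simp only [contraction, add_mul, mul_add, smul_mul_assoc, mul_smul_comm, trace_add, trace_smul,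
    smul_eq_mul]
  ring

theorem dirac_eq' {n : ℕ} (i : Fin n) :
    (dirac i : Op n) =
      (1 / 2 : ℂ) • majorana (evenIdx i) + (Complex.I / 2) • majorana (oddIdx i) := by
  rw [dirac_eq, smul_add, smul_smul, one_div_mul_eq_div]

theorem dirac_conjTranspose' {n : ℕ} (i : Fin n) :
    (dirac i : Op n)ᴴ =
      (1 / 2 : ℂ) • majorana (evenIdx i) + (-Complex.I / 2) • majorana (oddIdx i) := by
  rw [dirac_conjTranspose, smul_sub, smul_smul, sub_eq_add_neg, ← neg_smul]
  congr 2; ring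

/-- The change from Majorana to Dirac operators is block diagonal in the modes, so the formula for
$\mathrm{Tr}[D^2]$ already holds for each pair of modes. The `if`s remove the diagonal value
$\langle c_\mu c_\mu\rangle=1$, which is not part of the antisymmetric matrix $K$. -/
theorem extDensity_block {n : ℕ} {ρ : Op n} (hρ : ρ.trace = 1) (i j : Fin n) :
    2 * (extDensity ρ (Sum.inl i) (Sum.inl j) * extDensity ρ (Sum.inl j) (Sum.inl i) +
      extDensity ρ (Sum.inl i) (Sum.inr j) * extDensity ρ (Sum.inr j) (Sum.inl i) +
      (extDensity ρ (Sum.inr i) (Sum.inl j) * extDensity ρ (Sum.inl j) (Sum.inr i) +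
      extDensity ρ (Sum.inr i) (Sum.inr j) * extDensity ρ (Sum.inr j) (Sum.inr i))) =
    (if i = j then 1 else 0) - (1 / 2) *
      ((if evenIdx i = evenIdx j then 0 else contraction ρ (evenIdx i) (evenIdx j) ^ 2) +
        contraction ρ (evenIdx i) (oddIdx j) ^ 2 + (contraction ρ (oddIdx i) (evenIdx j) ^ 2 +
        if oddIdx i = oddIdx j then 0 else contraction ρ (oddIdx i) (oddIdx j) ^ 2)) := by
  simp only [extDensity, Matrix.sub_apply, Matrix.of_apply, gammaOp, Sum.elim_inl, Sum.elim_inr,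
    conjTranspose_conjTranspose]
  simp only [dirac_conjTranspose']
  simp only [dirac_eq', trace_mul_pair, Matrix.one_apply, Sum.inl.injEq, Sum.inr.injEq,
    reduceCtorEq, if_false, evenIdx_inj, oddIdx_inj]
  rcases eq_or_ne i j with rfl | h
  · simp only [if_true, contraction_self hρ, contraction_swap ρ (evenIdx_ne_oddIdx i i)]
    ring_nf
    simp only [Complex.I_sq, Complex.I_pow_four]
    ring
  · rw [contraction_swap ρ (fun e => h (evenIdx_inj.mp e)),
      contraction_swap ρ (fun e => h (oddIdx_inj.mp e)),
      contraction_swap ρ (evenIdx_ne_oddIdx i j), contraction_swap ρ (evenIdx_ne_oddIdx j i)]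
    simp only [h, h.symm, if_false]
    ring_nf
    simp only [Complex.I_sq, Complex.I_pow_four]
    ring

theorem trace_extDensity_sq {n : ℕ} {ρ : Op n} (hρ : ρ.trace = 1) :
    2 * (extDensity ρ * extDensity ρ).trace - (n : ℂ) =
      -∑ p : PairIndex n, (majoranaPair p * ρ).trace ^ 2 := by
  have h1 : ∑ p : PairIndex n, (majoranaPair p * ρ).trace ^ 2 =
      ∑ p : PairIndex n, if p.1.1 = p.1.2 then 0 else contraction ρ p.1.1 p.1.2 ^ 2 :=
    Finset.sum_congr rfl fun p _ => by
      rw [if_neg p.2.ne, contraction, majoranaPair, trace_mul_comm]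
  have h2 := sum_pairIndex (fun μ ν => if μ = ν then 0 else contraction ρ μ ν ^ 2)
    (fun μ ν => by
      rcases eq_or_ne μ ν with h | h
      · simp [h]
      · simp only [h, h.symm, if_false]
        rw [contraction_swap ρ h, neg_sq])
    (fun μ => if_pos rfl)
  have h3 : ∑ p : PairIndex n, (majoranaPair p * ρ).trace ^ 2 = (1 / 2) *
      ∑ μ, ∑ ν, if μ = ν then 0 else contraction ρ μ ν ^ 2 := by
    rw [h1, h2]; ring
  rw [h3, sum_evenIdx_oddIdx, ← Finset.sum_add_distrib]
  simp only [sum_evenIdx_oddIdx, ← Finset.sum_add_distrib, evenIdx_ne_oddIdx,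
    (evenIdx_ne_oddIdx _ _).symm, if_false]
  have h4 : 2 * (extDensity ρ * extDensity ρ).trace = ∑ i, ∑ j, 2 *
      (extDensity ρ (Sum.inl i) (Sum.inl j) * extDensity ρ (Sum.inl j) (Sum.inl i) +
      extDensity ρ (Sum.inl i) (Sum.inr j) * extDensity ρ (Sum.inr j) (Sum.inl i) +
      (extDensity ρ (Sum.inr i) (Sum.inl j) * extDensity ρ (Sum.inl j) (Sum.inr i) +
      extDensity ρ (Sum.inr i) (Sum.inr j) * extDensity ρ (Sum.inr j) (Sum.inr i))) := by
    simp only [Matrix.trace, Matrix.diag, Matrix.mul_apply, Fintype.sum_sum_type,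
      ← Finset.mul_sum, ← Finset.sum_add_distrib]
  rw [h4]
  simp only [extDensity_block hρ, Finset.sum_sub_distrib, ← Finset.mul_sum]
  simp

theorem trace_extDensity {n : ℕ} {ρ : Op n} (hρ : ρ.trace = 1) : (extDensity ρ).trace = n := by
  have h : ∀ i : Fin n, extDensity ρ (Sum.inl i) (Sum.inl i) +
      extDensity ρ (Sum.inr i) (Sum.inr i) = 1 := fun i => by
    have hI := Complex.I_sq
    simp only [extDensity, Matrix.sub_apply, Matrix.of_apply, gammaOp, Sum.elim_inl, Sum.elim_inr,
      conjTranspose_conjTranspose]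
    simp only [dirac_conjTranspose']
    simp only [dirac_eq', trace_mul_pair, Matrix.one_apply_eq, contraction_self hρ]
    linear_combination (1 / 2 : ℂ) * hI
  simp only [Matrix.trace, Matrix.diag, Fintype.sum_sum_type, ← Finset.sum_add_distrib, h]
  simp

theorem sub_linEntropy {n : ℕ} {ρ : Op n} (hρ : ρ.trace = 1) :
    (n : ℂ) - linEntropy ρ = 2 * (extDensity ρ * extDensity ρ).trace - (n : ℂ) := by
  rw [linEntropy, mul_sub, mul_one, trace_sub, trace_extDensity hρ]
  ring

/-! ### Exponentials and the group -/

/-- Here $e^AXe^{-A}=e^{\mathrm{ad}_A}X$, because left and right multiplications commute. The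
partial sums of the series lie in `V`, which is closed by finite dimension. -/
theorem exp_conj_mem_normed {𝔸 : Type*} [NormedRing 𝔸] [NormedAlgebra ℂ 𝔸] [FiniteDimensional ℂ 𝔸]
    (V : Submodule ℂ 𝔸) (A : 𝔸) (hA : ∀ X ∈ V, A * X - X * A ∈ V) {X : 𝔸} (hX : X ∈ V) :
    NormedSpace.exp A * X * NormedSpace.exp (-A) ∈ V := by
  have : CompleteSpace 𝔸 := FiniteDimensional.complete ℂ 𝔸
  let L : 𝔸 →+* (𝔸 →L[ℂ] 𝔸) :=
    { toFun := fun a => ContinuousLinearMap.mul ℂ 𝔸 a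
      map_one' := by ext; simp
      map_mul' := fun a b => by ext; simp [mul_assoc]
      map_zero' := by simp
      map_add' := by simp }
  -- Right multiplication reverses products, so it is a ring homomorphism only from the opposite
  -- algebra.
  let R : 𝔸ᵐᵒᵖ →+* (𝔸 →L[ℂ] 𝔸) :=
    { toFun := fun a => (ContinuousLinearMap.mul ℂ 𝔸).flip a.unop
      map_one' := by ext; simp
      map_mul' := fun a b => by ext; simp [mul_assoc]
      map_zero' := by simp
      map_add' := by simp }
  have hL : Continuous L := (ContinuousLinearMap.mul ℂ 𝔸).continuous
  have hR : Continuous R :=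
    (ContinuousLinearMap.mul ℂ 𝔸).flip.continuous.comp MulOpposite.continuous_unop
  let _ : NormedAlgebra ℚ 𝔸 := NormedAlgebra.restrictScalars ℚ ℂ 𝔸
  let _ : NormedAlgebra ℚ (𝔸 →L[ℂ] 𝔸) := NormedAlgebra.restrictScalars ℚ ℂ (𝔸 →L[ℂ] 𝔸)
  have hcomm : Commute (L A) (R (MulOpposite.op (-A))) := by
    ext Y; simp [L, R, mul_assoc]
  have e1 : NormedSpace.exp A * X * NormedSpace.exp (-A) =
      NormedSpace.exp (L A + R (MulOpposite.op (-A))) X := by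
    rw [NormedSpace.exp_add_of_commute hcomm, ← NormedSpace.map_exp L hL,
      ← NormedSpace.map_exp R hR, NormedSpace.exp_op]
    simp [L, R, mul_assoc]
  have hpow : ∀ k : ℕ, ((L A + R (MulOpposite.op (-A))) ^ k) X ∈ V := fun k => by
    induction k with
    | zero => simpa using hX
    | succ k ih =>
      rw [pow_succ']
      have := hA _ ih
      simpa [L, R, sub_eq_add_neg] using this
  have hs := (ContinuousLinearMap.apply ℂ 𝔸 X).hasSum
    (NormedSpace.exp_series_hasSum_exp' (𝕂 := ℂ) (L A + R (MulOpposite.op (-A))))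
  rw [e1]
  refine V.closed_of_finiteDimensional.mem_of_tendsto hs (Filter.Eventually.of_forall fun s => ?_)
  exact sum_mem fun k _ => by simpa using V.smul_mem _ (hpow k)

theorem exp_conj_mem {n : ℕ} (V : Submodule ℂ (Op n)) (A : Op n)
    (hA : ∀ X ∈ V, A * X - X * A ∈ V) {X : Op n} (hX : X ∈ V) :
    NormedSpace.exp A * X * NormedSpace.exp (-A) ∈ V :=
  -- The norm is auxiliary: the conclusion does not mention it, and it induces the usual topology on
  -- matrices.
  @exp_conj_mem_normed (Op n) Matrix.linftyOpNormedRing Matrix.linftyOpNormedAlgebra _ V A hA X hX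

/-- Euler's formula, transported along the algebra map $\mathbb C\to\mathfrak A$ that sends $i$ to
`J`. -/
theorem exp_smul_normed {𝔸 : Type*} [NormedRing 𝔸] [NormedAlgebra ℝ 𝔸] {J : 𝔸}
    (hJ : J * J = -1) (θ : ℝ) :
    NormedSpace.exp (θ • J) = Real.cos θ • (1 : 𝔸) + Real.sin θ • J := by
  let _ : NormedAlgebra ℚ 𝔸 := NormedAlgebra.restrictScalars ℚ ℝ 𝔸
  have hc : Continuous (Complex.liftAux J hJ) :=
    (Complex.liftAux J hJ).toLinearMap.continuous_of_finiteDimensional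
  have h := NormedSpace.map_exp (Complex.liftAux J hJ) hc (θ * Complex.I)
  rw [← Complex.exp_eq_exp_ℂ] at h
  simp only [Complex.liftAux_apply, Algebra.algebraMap_eq_smul_one,
    Complex.exp_ofReal_mul_I_re, Complex.exp_ofReal_mul_I_im] at h
  simpa using h.symm

theorem exp_smul_of_sq {n : ℕ} {J : Op n} (hJ : J * J = -1) (θ : ℝ) :
    NormedSpace.exp (θ • J) = Real.cos θ • (1 : Op n) + Real.sin θ • J :=
  @exp_smul_normed (Op n) Matrix.linftyOpNormedRing Matrix.linftyOpNormedAlgebra J hJ θ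

theorem exp_continuous_normed {𝔸 : Type*} [NormedRing 𝔸] [NormedAlgebra ℂ 𝔸]
    [FiniteDimensional ℂ 𝔸] : Continuous (NormedSpace.exp : 𝔸 → 𝔸) := by
  have : CompleteSpace 𝔸 := FiniteDimensional.complete ℂ 𝔸
  let _ : NormedAlgebra ℚ 𝔸 := NormedAlgebra.restrictScalars ℚ ℂ 𝔸
  exact NormedSpace.exp_continuous

theorem exp_continuous_op (n : ℕ) : Continuous (NormedSpace.exp : Op n → Op n) :=
  @exp_continuous_normed (Op n) Matrix.linftyOpNormedRing Matrix.linftyOpNormedAlgebra _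

theorem exp_mem_unitaryGroup {n : ℕ} {A : Op n} (hA : Aᴴ = -A) :
    NormedSpace.exp A ∈ Matrix.unitaryGroup (Fin n → Fin 2) ℂ := by
  rw [Matrix.mem_unitaryGroup_iff, star_eq_conjTranspose, ← Matrix.exp_conjTranspose, hA,
    ← Matrix.exp_add_of_commute _ _ (Commute.refl A).neg_right, add_neg_cancel,
    NormedSpace.exp_zero]

theorem dla_conjTranspose {n : ℕ} {A : Op n} (hA : A ∈ dla n) : Aᴴ = -A := by
  obtain ⟨h, rfl⟩ := exists_coeff_of_mem_dla hA
  rw [conjTranspose_sum, ← Finset.sum_neg_distrib]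
  refine Finset.sum_congr rfl fun p _ => ?_
  rw [conjTranspose_smul, majoranaPair_conjTranspose, smul_neg, star_trivial]

theorem mem_pairSpan_of_mem_dla {n : ℕ} {A : Op n} (hA : A ∈ dla n) : A ∈ pairSpan n := by
  rw [← span_dla]
  exact Submodule.subset_span hA

theorem commutator_mem_pairSpan {n : ℕ} {A X : Op n} (hA : A ∈ dla n) (hX : X ∈ pairSpan n) :
    A * X - X * A ∈ pairSpan n := by
  refine Submodule.span_induction ?_ ?_ ?_ ?_ hX
  · rintro _ ⟨p, rfl⟩
    exact mem_pairSpan_of_mem_dla ((dla n).lie_mem hA (majoranaPair_mem_dla p))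
  · simp
  · intro x y _ _ h1 h2
    convert add_mem h1 h2 using 1; noncomm_ring
  · intro a x _ h
    convert Submodule.smul_mem _ a h using 1
    rw [smul_mul_assoc, mul_smul_comm, smul_sub]

theorem groupOp_mem_unitaryGroup {n : ℕ} (u : group n) :
    groupOp u ∈ Matrix.unitaryGroup (Fin n → Fin 2) ℂ :=
  (u : Matrix.unitaryGroup (Fin n → Fin 2) ℂ).2

theorem groupOp_mul_conjTranspose {n : ℕ} (u : group n) : groupOp u * (groupOp u)ᴴ = 1 :=
  Matrix.mem_unitaryGroup_iff.mp (groupOp_mem_unitaryGroup u)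

theorem conjTranspose_mul_groupOp {n : ℕ} (u : group n) : (groupOp u)ᴴ * groupOp u = 1 :=
  Matrix.mem_unitaryGroup_iff'.mp (groupOp_mem_unitaryGroup u)

theorem groupOp_mul {n : ℕ} (u v : group n) : groupOp (u * v) = groupOp u * groupOp v := rfl

theorem continuous_groupOp (n : ℕ) : Continuous (groupOp (n := n)) :=
  continuous_subtype_val.comp continuous_subtype_val

theorem groupOp_conj_mem {n : ℕ} (u : group n) {X : Op n} (hX : X ∈ pairSpan n) :
    (groupOp u)ᴴ * X * groupOp u ∈ pairSpan n := by
  -- Both directions of conjugation are carried through the induction because passing to the inverse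
  -- exchanges them.
  have key : ∀ w ∈ group n, (∀ X ∈ pairSpan n, (w : Op n) * X * (w : Op n)ᴴ ∈ pairSpan n) ∧
      ∀ X ∈ pairSpan n, (w : Op n)ᴴ * X * (w : Op n) ∈ pairSpan n := by
    intro w hw
    refine Subgroup.closure_induction (p := fun (w : Matrix.unitaryGroup (Fin n → Fin 2) ℂ) _ =>
      (∀ X ∈ pairSpan n, (w : Op n) * X * (w : Op n)ᴴ ∈ pairSpan n) ∧
      ∀ X ∈ pairSpan n, (w : Op n)ᴴ * X * (w : Op n) ∈ pairSpan n) ?_ ?_ ?_ ?_ hw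
    · rintro w ⟨A, hA, hw⟩
      have hw' : (w : Op n)ᴴ = NormedSpace.exp (-A) := by
        rw [hw, ← Matrix.exp_conjTranspose, dla_conjTranspose hA]
      rw [hw', hw]
      refine ⟨fun X hX => exp_conj_mem _ A (fun X hX => commutator_mem_pairSpan hA hX) hX,
        fun X hX => ?_⟩
      have := exp_conj_mem (pairSpan n) (-A)
        (fun X hX => commutator_mem_pairSpan (neg_mem hA) hX) hX
      rwa [neg_neg] at this
    · simp
    · intro x y _ _ hx hy
      refine ⟨fun X hX => ?_, fun X hX => ?_⟩
      · have := hx.1 _ (hy.1 X hX)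
        simpa [mul_assoc] using this
      · have := hy.2 _ (hx.2 X hX)
        simpa [mul_assoc] using this
    · intro x _ hx
      refine ⟨fun X hX => ?_, fun X hX => ?_⟩
      · simpa [star_eq_conjTranspose] using hx.2 X hX
      · simpa [star_eq_conjTranspose] using hx.1 X hX
  exact (key u u.2).2 X hX

theorem exists_groupOp_eq_exp {n : ℕ} {A : Op n} (hA : A ∈ dla n) :
    ∃ u : group n, groupOp u = NormedSpace.exp A :=
  ⟨⟨⟨_, exp_mem_unitaryGroup (dla_conjTranspose hA)⟩, Subgroup.subset_closure ⟨A, hA, rfl⟩⟩, rfl⟩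

theorem majorana_pair_mem_dla {n : ℕ} {μ ν : Fin (2 * n)} (h : μ ≠ ν) :
    (majorana μ : Op n) * majorana ν ∈ dla n :=
  mem_dla_iff.mpr (majorana_pair_mem_span ℝ h)

theorem exists_groupOp_eq_majorana_pair {n : ℕ} {μ ν : Fin (2 * n)} (h : μ ≠ ν) :
    ∃ u : group n, groupOp u = majorana μ * majorana ν := by
  obtain ⟨u, hu⟩ := exists_groupOp_eq_exp ((dla n).smul_mem (Real.pi / 2)
    (majorana_pair_mem_dla h))
  refine ⟨u, hu.trans ?_⟩
  rw [exp_smul_of_sq (majorana_pair_sq h)]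
  simp

theorem exists_groupOp_eq_rotation {n : ℕ} {μ ν : Fin (2 * n)} (h : μ ≠ ν) :
    ∃ u : group n, groupOp u = (√2 / 2) • (1 + (majorana μ : Op n) * majorana ν) := by
  obtain ⟨u, hu⟩ := exists_groupOp_eq_exp ((dla n).smul_mem (Real.pi / 4)
    (majorana_pair_mem_dla h))
  refine ⟨u, hu.trans ?_⟩
  rw [exp_smul_of_sq (majorana_pair_sq h), Real.cos_pi_div_four, Real.sin_pi_div_four, smul_add]

/-! ### The invariant quadratic form -/

theorem pairSpan_expand {n : ℕ} {X : Op n} (hX : X ∈ pairSpan n) :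
    X = ∑ q, (-(2 ^ n : ℂ)⁻¹ * (X * majoranaPair q).trace) • majoranaPair q := by
  refine Submodule.span_induction ?_ ?_ ?_ ?_ hX
  · rintro _ ⟨p, rfl⟩
    have h2 : (2 ^ n : ℂ) ≠ 0 := by positivity
    simp only [trace_majoranaPair_mul, mul_ite, mul_zero, ite_smul, zero_smul]
    rw [Finset.sum_ite_eq Finset.univ, if_pos (Finset.mem_univ _), neg_mul_neg,
      inv_mul_cancel₀ h2, one_smul]
  · simp
  · intro x y _ _ hx hy
    conv_lhs => rw [hx, hy]
    simp only [add_mul, trace_add, mul_add, add_smul, Finset.sum_add_distrib]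
  · intro a x _ hx
    conv_lhs => rw [hx]
    simp only [Finset.smul_sum, smul_mul_assoc, trace_smul, smul_smul, smul_eq_mul]
    exact Finset.sum_congr rfl fun q _ => by congr 1; ring

theorem loss_eq_trace_conj {n : ℕ} (U ρ X : Op n) : loss U ρ X = (Uᴴ * X * U * ρ).trace := by
  rw [loss, mul_assoc (U * ρ), mul_assoc U, trace_mul_comm]
  rw [mul_assoc ρ, trace_mul_comm]

theorem loss_groupOp_mul {n : ℕ} (v u : group n) (ρ X : Op n) :
    loss (groupOp (v * u)) ρ X = loss (groupOp u) ρ ((groupOp v)ᴴ * X * groupOp v) := by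
  simp only [loss_eq_trace_conj, groupOp_mul, conjTranspose_mul, mul_assoc]

theorem loss_neg {n : ℕ} (U ρ X : Op n) : loss U ρ (-X) = -loss U ρ X := by
  simp [loss]

theorem loss_smul {n : ℕ} (U ρ X : Op n) (a : ℂ) : loss U ρ (a • X) = a * loss U ρ X := by
  simp [loss]

theorem loss_sum {n : ℕ} {ι : Type*} (s : Finset ι) (U ρ : Op n) (X : ι → Op n) :
    loss U ρ (∑ i ∈ s, X i) = ∑ i ∈ s, loss U ρ (X i) := by
  simp [loss, Finset.mul_sum, trace_sum]

/-- In the basis of pairs, conjugation by `u` has a matrix `R` preserving the bilinear trace form,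
so $RR^t=1$. The invariant needs $R^tR=1$, which follows since `R` is square. The sum is one of
squares, not of squared moduli. -/
theorem sum_loss_majoranaPair_sq {n : ℕ} (u : group n) (ρ : Op n) :
    ∑ p, loss (groupOp u) ρ (majoranaPair p) ^ 2 = ∑ p, (majoranaPair p * ρ).trace ^ 2 := by
  have h2 : (2 ^ n : ℂ) ≠ 0 := by positivity
  let C : PairIndex n → Op n := fun p => (groupOp u)ᴴ * majoranaPair p * groupOp u
  let R : Matrix (PairIndex n) (PairIndex n) ℂ :=
    Matrix.of fun p q => -(2 ^ n : ℂ)⁻¹ * (C p * majoranaPair q).trace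
  have hC : ∀ p, C p = ∑ q, R p q • majoranaPair q := fun p =>
    pairSpan_expand (groupOp_conj_mem u (Submodule.subset_span ⟨p, rfl⟩))
  have hCC : ∀ p q, (C p * C q).trace = if p = q then -2 ^ n else 0 := fun p q => by
    rw [← trace_majoranaPair_mul]
    have : C p * C q = (groupOp u)ᴴ * (majoranaPair p * majoranaPair q * groupOp u) := by
      simp only [C, mul_assoc]
      rw [← mul_assoc (groupOp u) (groupOp u)ᴴ, groupOp_mul_conjTranspose, one_mul]
    rw [this, trace_mul_comm, mul_assoc, groupOp_mul_conjTranspose, mul_one]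
  have hRR : R * Rᵀ = 1 := by
    ext p q
    have h : (C p * C q).trace = -2 ^ n * (R * Rᵀ) p q := by
      conv_lhs => rw [hC q]
      simp only [Finset.mul_sum, trace_sum, mul_smul_comm, trace_smul, smul_eq_mul,
        Matrix.mul_apply, Matrix.transpose_apply]
      refine Finset.sum_congr rfl fun r _ => ?_
      simp only [R, Matrix.of_apply]
      field_simp
    rw [hCC] at h
    rw [Matrix.one_apply]
    split_ifs at h ⊢ with hpq
    · exact mul_left_cancel₀ (neg_ne_zero.mpr h2) (h.symm.trans (mul_one _).symm)
    · exact (mul_eq_zero.mp h.symm).resolve_left (neg_ne_zero.mpr h2)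
  have hRR' : Rᵀ * R = 1 := mul_eq_one_comm.mp hRR
  let s : PairIndex n → ℂ := fun q => (majoranaPair q * ρ).trace
  have hl : (fun p => loss (groupOp u) ρ (majoranaPair p)) = R *ᵥ s := by
    ext p
    rw [loss_eq_trace_conj]
    change (C p * ρ).trace = _
    rw [hC p]
    simp [Finset.sum_mul, trace_sum, Matrix.mulVec, dotProduct, s]
  have h1 : ∑ p, loss (groupOp u) ρ (majoranaPair p) ^ 2 = (R *ᵥ s) ⬝ᵥ (R *ᵥ s) := by
    rw [← hl]; simp [dotProduct, sq]
  rw [h1, Matrix.dotProduct_mulVec, Matrix.vecMul_mulVec, hRR', Matrix.vecMul_one]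
  simp [dotProduct, sq, s]

/-! ### Integrals over unitary operators -/

/-- Entries of a unitary have modulus at most 1, so `U` takes values in a compact box on which `f`
is bounded. Compactness of the parameter space is not needed, so the same bound serves the group and
the circuit. -/
theorem integrable_comp_unitary {n : ℕ} {Θ : Type*} [MeasurableSpace Θ] [TopologicalSpace Θ]
    [OpensMeasurableSpace Θ] (ν : Measure Θ) [IsFiniteMeasure ν] {U : Θ → Op n}
    (hU : Continuous U) (hu : ∀ θ, U θ ∈ Matrix.unitaryGroup (Fin n → Fin 2) ℂ) {f : Op n → ℂ}
    (hf : Continuous f) : Integrable (fun θ => f (U θ)) ν := by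
  have hK : IsCompact (Set.pi Set.univ fun _ : Fin n → Fin 2 =>
      Set.pi Set.univ fun _ : Fin n → Fin 2 => Metric.closedBall (0 : ℂ) 1) :=
    isCompact_univ_pi fun _ => isCompact_univ_pi fun _ => isCompact_closedBall _ _
  obtain ⟨C, hC⟩ := hK.exists_bound_of_continuousOn (f := fun M => f (Matrix.of M))
    (hf.continuousOn)
  refine Integrable.of_bound (hf.comp hU).aestronglyMeasurable C (Filter.Eventually.of_forall
    fun θ => hC (U θ) ?_)
  intro i _ j _
  simpa using entry_norm_bound_of_unitary (hu θ) i j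

theorem continuous_loss {n : ℕ} (ρ X : Op n) : Continuous fun U : Op n => loss U ρ X := by
  exact (((continuous_id.matrix_mul continuous_const).matrix_mul
    continuous_id.matrix_conjTranspose).matrix_mul continuous_const).matrix_trace

/-! ### Second moments over the group -/

theorem integral_loss_sq_comm {n : ℕ} (μ : Measure (group n)) (ρ : Op n) {α κ : Fin (2 * n)}
    (h : α ≠ κ) :
    ∫ u, loss (groupOp u) ρ (majorana α * majorana κ) *
        loss (groupOp u) ρ (majorana α * majorana κ) ∂μ =
      ∫ u, loss (groupOp u) ρ (majorana κ * majorana α) *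
        loss (groupOp u) ρ (majorana κ * majorana α) ∂μ := by
  rw [majorana_anticomm h]
  simp only [loss_neg, neg_mul_neg]

section Haar

variable {n : ℕ} (μ : Measure (group n)) [μ.IsHaarMeasure]

/-- Left translation by `v` moves onto the observable, so this is left invariance of the Haar
measure. -/
theorem integral_loss_conj (ρ X : Op n) (v : group n) :
    ∫ u, loss (groupOp u) ρ ((groupOp v)ᴴ * X * groupOp v) ∂μ =
      ∫ u, loss (groupOp u) ρ X ∂μ := by
  simp only [← loss_groupOp_mul]
  exact integral_mul_left_eq_self (fun u => loss (groupOp u) ρ X) v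

theorem integral_loss_mul_loss_conj (ρ X Y : Op n) (v : group n) :
    ∫ u, loss (groupOp u) ρ ((groupOp v)ᴴ * X * groupOp v) *
        loss (groupOp u) ρ ((groupOp v)ᴴ * Y * groupOp v) ∂μ =
      ∫ u, loss (groupOp u) ρ X * loss (groupOp u) ρ Y ∂μ := by
  simp only [← loss_groupOp_mul]
  exact integral_mul_left_eq_self (fun u => loss (groupOp u) ρ X * loss (groupOp u) ρ Y) v

/-- The sign in the commutation relation of `c α` and `c μ * c ν`. -/
def pairSign (α : Fin (2 * n)) (p : PairIndex n) : ℂ :=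
  if α = p.1.1 ∨ α = p.1.2 then -1 else 1

theorem majorana_mul_majoranaPair (α : Fin (2 * n)) (p : PairIndex n) :
    majorana α * majoranaPair p = pairSign α p • (majoranaPair p * majorana α) := by
  rw [pairSign, majoranaPair]
  split_ifs with h
  · rw [majorana_pair_anticomm p.2.ne h, neg_one_smul]
  · rw [not_or] at h
    rw [majorana_pair_comm h.1 h.2, one_smul]

theorem pairSign_mul_self (α : Fin (2 * n)) (p : PairIndex n) :
    pairSign α p * pairSign α p = 1 := by
  unfold pairSign; split_ifs <;> norm_num

theorem majoranaPair_conj {α β : Fin (2 * n)} {v : group n}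
    (hv : groupOp v = majorana α * majorana β) (p : PairIndex n) :
    (groupOp v)ᴴ * majoranaPair p * groupOp v =
      (pairSign α p * pairSign β p) • majoranaPair p := by
  have h1 : groupOp v * majoranaPair p =
      (pairSign α p * pairSign β p) • (majoranaPair p * groupOp v) := by
    rw [hv, mul_assoc, majorana_mul_majoranaPair, mul_smul_comm, ← mul_assoc,
      majorana_mul_majoranaPair, smul_mul_assoc, smul_smul, mul_comm, mul_assoc]
  have h2 : majoranaPair p * groupOp v =
      (pairSign α p * pairSign β p) • (groupOp v * majoranaPair p) := by
    rw [h1, smul_smul, mul_mul_mul_comm, pairSign_mul_self, pairSign_mul_self, one_mul, one_smul]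
  rw [mul_assoc, h2, mul_smul_comm, ← mul_assoc, conjTranspose_mul_groupOp, one_mul]

/-- With `β` outside `p`, available since $2n>2$, conjugation by $c_{p_1}c_\beta$ flips the sign of
$c_p$. -/
theorem integral_loss_majoranaPair (hn : 2 ≤ n) (ρ : Op n) (p : PairIndex n) :
    ∫ u, loss (groupOp u) ρ (majoranaPair p) ∂μ = 0 := by
  obtain ⟨β, hβ⟩ : ∃ β, β ∉ ({p.1.1, p.1.2} : Finset (Fin (2 * n))) := by
    refine Finset.exists_mem_notMem_of_card_lt_card (s := {p.1.1, p.1.2}) (t := Finset.univ) ?_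
      |>.imp fun _ h => h.2
    refine Finset.card_le_two.trans_lt ?_
    simp; omega
  simp only [Finset.mem_insert, Finset.mem_singleton] at hβ
  obtain ⟨v, hv⟩ := exists_groupOp_eq_majorana_pair (n := n) (μ := p.1.1) (ν := β)
    (fun h => hβ (Or.inl h.symm))
  have h := integral_loss_conj μ ρ (majoranaPair p) v
  rw [majoranaPair_conj hv] at h
  have hs : pairSign p.1.1 p * pairSign β p = -1 := by
    simp [pairSign, hβ]
  simp only [hs, neg_one_smul, loss_neg, integral_neg] at h
  exact self_eq_neg.mp h.symm

/-- Conjugation by $c_\alpha c_\beta$ multiplies the integrand by the product of the two given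
signs, which is $-1$. -/
theorem integral_loss_mul_loss_eq_zero (ρ : Op n) {p q : PairIndex n} {α β : Fin (2 * n)}
    (hαβ : α ≠ β) (hα : pairSign α p * pairSign α q = -1)
    (hβ : pairSign β p * pairSign β q = 1) :
    ∫ u, loss (groupOp u) ρ (majoranaPair p) * loss (groupOp u) ρ (majoranaPair q) ∂μ = 0 := by
  obtain ⟨v, hv⟩ := exists_groupOp_eq_majorana_pair hαβ
  have h := integral_loss_mul_loss_conj μ ρ (majoranaPair p) (majoranaPair q) v
  rw [majoranaPair_conj hv, majoranaPair_conj hv] at h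
  have hs : ∀ x y : ℂ, pairSign α p * pairSign β p * x * (pairSign α q * pairSign β q * y) =
      -(x * y) := fun x y => by
    linear_combination (x * y * (pairSign β p * pairSign β q)) * hα - x * y * hβ
  simp only [loss_smul, hs, integral_neg] at h
  exact self_eq_neg.mp h.symm

/-- Conjugation doubles the angle $\pi/4$: it is a quarter turn taking $c_\alpha$ to $c_\beta$ and
fixing $c_\kappa$, which commutes with $J=c_\alpha c_\beta$. -/
theorem majorana_pair_rotation {α β κ : Fin (2 * n)} (hαβ : α ≠ β) (hα : κ ≠ α) (hβ : κ ≠ β)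
    {v : group n} (hv : groupOp v = (√2 / 2) • (1 + (majorana α : Op n) * majorana β)) :
    (groupOp v)ᴴ * (majorana α * majorana κ) * groupOp v = majorana β * majorana κ := by
  set J : Op n := majorana α * majorana β with hJ
  have h1 : J * majorana α = -(majorana α * J) := by
    rw [majorana_pair_anticomm hαβ (Or.inl rfl), neg_neg]
  have h2 : majorana κ * J = J * majorana κ := majorana_pair_comm hα hβ
  have h3 : J * J = -1 := majorana_pair_sq hαβ
  have h4 : majorana α * J = majorana β := majorana_mul_cancel α _
  have h5 : (groupOp v)ᴴ = (√2 / 2) • (1 - J) := by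
    rw [hv, conjTranspose_smul, conjTranspose_add, conjTranspose_one,
      majorana_pair_conjTranspose hαβ, star_trivial, sub_eq_add_neg]
  have h6 : (1 - J) * (majorana α * majorana κ) * (1 + J) =
      (2 : ℝ) • (majorana β * majorana κ) := by
    calc (1 - J) * (majorana α * majorana κ) * (1 + J)
        = (majorana α - J * majorana α) * (majorana κ + majorana κ * J) := by noncomm_ring
      _ = majorana α * (1 + J) * (1 + J) * majorana κ := by rw [h1, h2]; noncomm_ring
      _ = (majorana α + (2 : ℝ) • (majorana α * J) + majorana α * (J * J)) * majorana κ := by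
        rw [two_smul]; noncomm_ring
      _ = _ := by rw [h3, h4, mul_neg, mul_one, add_neg_cancel_comm, smul_mul_assoc]
  rw [h5, hv, smul_mul_assoc, smul_mul_smul_comm, h6, smul_smul]
  have h7 : √2 / 2 * (√2 / 2) * 2 = (1 : ℝ) := by
    have := Real.mul_self_sqrt (zero_le_two (α := ℝ))
    linear_combination (1 / 2) * this
  rw [h7, one_smul]

theorem integral_loss_sq_swap (ρ : Op n) {α β κ : Fin (2 * n)} (hα : κ ≠ α) (hβ : κ ≠ β) :
    ∫ u, loss (groupOp u) ρ (majorana α * majorana κ) *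
        loss (groupOp u) ρ (majorana α * majorana κ) ∂μ =
      ∫ u, loss (groupOp u) ρ (majorana β * majorana κ) *
        loss (groupOp u) ρ (majorana β * majorana κ) ∂μ := by
  rcases eq_or_ne α β with rfl | hαβ
  · rfl
  obtain ⟨v, hv⟩ := exists_groupOp_eq_rotation hαβ
  have h := integral_loss_mul_loss_conj μ ρ (majorana α * majorana κ) (majorana α * majorana κ) v
  rw [majorana_pair_rotation hαβ hα hβ hv] at h
  exact h.symm

theorem integral_loss_sq_eq (ρ : Op n) (p q : PairIndex n) :
    ∫ u, loss (groupOp u) ρ (majoranaPair p) * loss (groupOp u) ρ (majoranaPair p) ∂μ =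
      ∫ u, loss (groupOp u) ρ (majoranaPair q) * loss (groupOp u) ρ (majoranaPair q) ∂μ := by
  obtain ⟨⟨a, b⟩, hp⟩ := p
  obtain ⟨⟨c, d⟩, hq⟩ := q
  have hab : a ≠ b := hp.ne
  have hcd : c ≠ d := hq.ne
  simp only [majoranaPair]
  -- One index is replaced at a time while the other stays fixed. If `c = b` a single move suffices;
  -- otherwise `a` goes to `c`, then `b` to `d`.
  rcases eq_or_ne c b with rfl | hcb
  · rw [integral_loss_sq_comm μ ρ hab, integral_loss_sq_comm μ ρ hcd]
    rw [integral_loss_sq_comm μ ρ hab.symm, integral_loss_sq_swap μ ρ hab.symm hcd]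
  · rw [integral_loss_sq_swap μ ρ hab.symm hcb.symm, integral_loss_sq_comm μ ρ hcb,
      integral_loss_sq_swap μ ρ hcb hcd, integral_loss_sq_comm μ ρ hcd.symm]

/-- If $c_p$ and the operator have opposite commutation signs with $c_\alpha$, their product
anticommutes with $c_\alpha$ and is traceless; that trace is $-2^n$ times the coefficient. -/
theorem coeff_eq_zero_of_majorana {h : PairIndex n → ℂ} {p : PairIndex n} {α : Fin (2 * n)}
    {s : ℂ} (hO : (∑ r, h r • majoranaPair r) * majorana α =
      s • (majorana α * ∑ r, h r • majoranaPair r)) (hs : pairSign α p * s = -1) : h p = 0 := by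
  set O : Op n := ∑ r, h r • majoranaPair r with hOdef
  have h1 : (majoranaPair p * O).trace = 0 := by
    have hs' : pairSign α p = -s := by
      linear_combination pairSign α p * hs - s * pairSign_mul_self α p
    apply trace_eq_zero_of_majorana_anticomm α
    rw [← mul_assoc, majorana_mul_majoranaPair, smul_mul_assoc, mul_assoc, mul_assoc, hO,
      mul_smul_comm, ← neg_smul, hs']
  have h2 : (majoranaPair p * O).trace = -2 ^ n * h p := by
    simp only [hOdef, Finset.mul_sum, trace_sum, mul_smul_comm, trace_smul,
      trace_majoranaPair_mul, smul_eq_mul, mul_ite, mul_zero]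
    rw [Finset.sum_ite_eq Finset.univ, if_pos (Finset.mem_univ _), mul_comm]
  rw [h1] at h2
  exact (mul_eq_zero.mp h2.symm).resolve_left (neg_ne_zero.mpr (by positivity))

end Haar

/-! ### The variance over the group -/

section Variance

variable {n : ℕ} (μ : Measure (group n)) [μ.IsHaarMeasure]

theorem coeff_mul_integral_eq_zero (hn : 2 ≤ n) (ρ : Op n) {g : PairIndex n → ℂ}
    (hP : n = 2 → IsPauli (∑ p, g p • majoranaPair p)) {p q : PairIndex n} (hpq : p ≠ q) :
    g p * g q *
      ∫ u, loss (groupOp u) ρ (majoranaPair p) * loss (groupOp u) ρ (majoranaPair q) ∂μ = 0 := by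
  obtain ⟨α, hαp, hαq⟩ := PairIndex.exists_mem_not_mem hpq
  have hsp : pairSign α p = -1 := if_pos hαp
  have hsq : pairSign α q = 1 := if_neg (not_or.mpr hαq)
  -- Such a `β` lies in both pairs or in neither. If there is none, the two pairs exhaust all $2n$
  -- indices, which forces $n=2$. A Pauli string commutes or anticommutes with $c_\alpha$, whereas
  -- $c_p$ anticommutes and $c_q$ commutes, so one of the two coefficients vanishes.
  by_cases hβ : ∃ β, α ≠ β ∧ pairSign β p * pairSign β q = 1
  · obtain ⟨β, hαβ, hβ⟩ := hβ
    rw [integral_loss_mul_loss_eq_zero μ ρ hαβ (by rw [hsp, hsq, mul_one]) hβ, mul_zero]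
  · push Not at hβ
    have hsub : (Finset.univ : Finset (Fin (2 * n))) ⊆ {p.1.1, p.1.2, q.1.1, q.1.2} := by
      intro β _
      by_contra hmem
      simp only [Finset.mem_insert, Finset.mem_singleton, not_or] at hmem
      refine hβ β ?_ ?_
      · rintro rfl
        rcases hαp with h | h
        · exact hmem.1 h
        · exact hmem.2.1 h
      · simp [pairSign, hmem]
    have hcard := (Finset.card_le_card hsub).trans Finset.card_le_four
    rw [Finset.card_univ, Fintype.card_fin] at hcard
    rcases (hP (by omega)).mul_majorana α with h | h
    · rw [coeff_eq_zero_of_majorana (h := g) (p := p) (s := 1) (by rw [h, one_smul])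
        (by rw [hsp, mul_one]), zero_mul, zero_mul]
    · rw [coeff_eq_zero_of_majorana (h := g) (p := q) (s := -1) (by rw [h, neg_one_smul])
        (by rw [hsq, one_mul]), mul_zero, zero_mul]

variable [IsProbabilityMeasure μ]

/-- The sum over pairs is constant on the group and all its terms have the same integral. -/
theorem card_mul_integral_loss_sq (ρ : Op n) (p : PairIndex n) :
    (Fintype.card (PairIndex n) : ℂ) *
      ∫ u, loss (groupOp u) ρ (majoranaPair p) * loss (groupOp u) ρ (majoranaPair p) ∂μ =
    ∑ q : PairIndex n, (majoranaPair q * ρ).trace ^ 2 := by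
  have h1 : ∀ u : group n, ∑ q, loss (groupOp u) ρ (majoranaPair q) *
      loss (groupOp u) ρ (majoranaPair q) = ∑ q : PairIndex n, (majoranaPair q * ρ).trace ^ 2 :=
    fun u => by simpa only [sq] using sum_loss_majoranaPair_sq u ρ
  have h2 : ∫ u : group n, ∑ q, loss (groupOp u) ρ (majoranaPair q) *
      loss (groupOp u) ρ (majoranaPair q) ∂μ =
        ∑ q : PairIndex n, (majoranaPair q * ρ).trace ^ 2 := by
    simp only [h1, integral_const, probReal_univ, one_smul]
  have hint : ∀ q : PairIndex n, Integrable (fun u => loss (groupOp u) ρ (majoranaPair q) *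
      loss (groupOp u) ρ (majoranaPair q)) μ := fun q =>
    integrable_comp_unitary μ (continuous_groupOp n) groupOp_mem_unitaryGroup
      ((continuous_loss ρ (majoranaPair q)).mul (continuous_loss ρ (majoranaPair q)))
  rw [← h2, integral_finsetSum _ fun q _ => hint q,
    Finset.sum_congr rfl fun q _ => integral_loss_sq_eq μ ρ q p, Finset.sum_const,
    Finset.card_univ, nsmul_eq_mul]

theorem integral_loss_eq_zero (hn : 2 ≤ n) (ρ : Op n) (g : PairIndex n → ℂ) :
    ∫ u, loss (groupOp u) ρ (∑ p, g p • majoranaPair p) ∂μ = 0 := by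
  simp only [loss_sum, loss_smul]
  rw [integral_finsetSum _ fun p _ => (integrable_comp_unitary μ (continuous_groupOp n)
    groupOp_mem_unitaryGroup (continuous_loss ρ (majoranaPair p))).const_mul (g p)]
  simp [integral_const_mul, integral_loss_majoranaPair μ hn]

theorem integral_loss_sq (hn : 2 ≤ n) (ρ : Op n) {g : PairIndex n → ℂ}
    (hg : ∑ p, g p ^ 2 = -1) (hP : n = 2 → IsPauli (∑ p, g p • majoranaPair p)) :
    ∫ u, loss (groupOp u) ρ (∑ p, g p • majoranaPair p) ^ 2 ∂μ =
      -(∑ q : PairIndex n, (majoranaPair q * ρ).trace ^ 2) / Fintype.card (PairIndex n) := by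
  have hne : (Fintype.card (PairIndex n) : ℂ) ≠ 0 := by
    have : Nonempty (PairIndex n) := ⟨⟨(⟨0, by omega⟩, ⟨1, by omega⟩), by simp [Fin.lt_def]⟩⟩
    exact_mod_cast Fintype.card_ne_zero
  have hint : ∀ p q : PairIndex n, Integrable (fun u => g p * g q *
      (loss (groupOp u) ρ (majoranaPair p) * loss (groupOp u) ρ (majoranaPair q))) μ :=
    fun p q => (integrable_comp_unitary μ (continuous_groupOp n) groupOp_mem_unitaryGroup
      ((continuous_loss ρ (majoranaPair p)).mul
        (continuous_loss ρ (majoranaPair q)))).const_mul _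
  have hexp : ∀ u : group n, loss (groupOp u) ρ (∑ p, g p • majoranaPair p) ^ 2 =
      ∑ p, ∑ q, g p * g q *
        (loss (groupOp u) ρ (majoranaPair p) * loss (groupOp u) ρ (majoranaPair q)) := fun u => by
    rw [sq, loss_sum, Finset.sum_mul_sum]
    simp only [loss_smul]
    exact Finset.sum_congr rfl fun p _ => Finset.sum_congr rfl fun q _ => by ring
  simp only [hexp]
  rw [integral_finsetSum _ fun p _ => integrable_finsetSum _ fun q _ => hint p q]
  have hterm : ∀ p, ∫ u, ∑ q, g p * g q *
      (loss (groupOp u) ρ (majoranaPair p) * loss (groupOp u) ρ (majoranaPair q)) ∂μ =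
      g p ^ 2 * ((∑ q : PairIndex n, (majoranaPair q * ρ).trace ^ 2) /
        Fintype.card (PairIndex n)) := fun p => by
    rw [integral_finsetSum _ fun q _ => hint p q]
    simp only [integral_const_mul]
    rw [Finset.sum_eq_single p
      (fun q _ hq => coeff_mul_integral_eq_zero μ hn ρ hP hq.symm) (by simp),
      ← card_mul_integral_loss_sq μ ρ p, mul_div_cancel_left₀ _ hne, sq]
  rw [Finset.sum_congr rfl fun p _ => hterm p, ← Finset.sum_mul, hg]
  ring

theorem lossVariance_group (hn : 2 ≤ n) {ρ : Op n} (hρ : ρ.trace = 1) {A : Op n}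
    (hA : A ∈ dla n) (hO : (Complex.I • A * Complex.I • A).trace = 2 ^ n)
    (hP : n = 2 → IsPauli (Complex.I • A)) :
    lossVariance μ groupOp ρ (Complex.I • A) =
      ((n : ℂ) - linEntropy ρ) / (Module.finrank ℝ (dla n) : ℂ) := by
  obtain ⟨h, rfl⟩ := exists_coeff_of_mem_dla hA
  have hsum : Complex.I • ∑ p, h p • majoranaPair p =
      ∑ p, (Complex.I * h p) • majoranaPair p := by
    rw [Finset.smul_sum]
    exact Finset.sum_congr rfl fun p _ => by rw [← Complex.coe_smul, smul_smul]
  rw [hsum] at hO hP ⊢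
  -- The normalization of $O$ read in the basis of pairs, where $\mathrm{Tr}[c_p^2]=-2^n$.
  have hg : ∑ p, (Complex.I * (h p : ℂ)) ^ 2 = -1 := by
    have h2 : (2 ^ n : ℂ) ≠ 0 := by positivity
    have hO' : -(2 ^ n) * ∑ p, (Complex.I * (h p : ℂ)) ^ 2 =
        ((∑ p, (Complex.I * (h p : ℂ)) • majoranaPair p) *
          ∑ p, (Complex.I * (h p : ℂ)) • majoranaPair p).trace := by
      simp only [Finset.sum_mul_sum, trace_sum, smul_mul_smul_comm, trace_smul,
        trace_majoranaPair_mul, smul_eq_mul, mul_ite, mul_zero]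
      simp only [Finset.sum_ite_eq, Finset.mem_univ, if_true, Finset.mul_sum]
      exact Finset.sum_congr rfl fun p _ => by ring
    refine mul_left_cancel₀ (neg_ne_zero.mpr h2) ?_
    rw [hO', hO, neg_mul_neg, mul_one]
  rw [lossVariance, integral_loss_eq_zero μ hn, integral_loss_sq μ hn ρ hg hP, finrank_dla,
    sub_linEntropy hρ, trace_extDensity_sq hρ]
  ring

end Variance

/-! ### Circuits -/

theorem circuit_mem_unitaryGroup {n L : ℕ} {H : Fin L → Op n} (hH : ∀ l, H l ∈ generators n)
    (θ : Fin L → ℝ) : circuit H θ ∈ Matrix.unitaryGroup (Fin n → Fin 2) ℂ := by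
  refine Submonoid.list_prod_mem _ fun U hU => ?_
  obtain ⟨l, rfl⟩ := (List.mem_ofFn' _ _).mp hU
  refine exp_mem_unitaryGroup ?_
  rw [conjTranspose_smul, generators_isHermitian (hH l), ← neg_smul]
  simp

theorem continuous_circuit {n L : ℕ} (H : Fin L → Op n) : Continuous (circuit H) := by
  unfold circuit
  simp only [List.ofFn_eq_map]
  refine continuous_list_prod _ fun l _ => (exp_continuous_op n).comp ?_
  exact ((continuous_const.mul (Complex.continuous_ofReal.comp (continuous_apply l))).neg).smul
    continuous_const

/-! ### Designs -/

theorem integral_trace_mul {m Θ : Type*} [Fintype m] [MeasurableSpace Θ] (ν : Measure Θ)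
    {F : Θ → Matrix m m ℂ} (hF : ∀ x y, Integrable (fun θ => F θ x y) ν) (B : Matrix m m ℂ) :
    ∫ θ, (F θ * B).trace ∂ν = ((Matrix.of fun x y => ∫ θ, F θ x y ∂ν) * B).trace := by
  simp only [Matrix.trace, Matrix.diag, Matrix.mul_apply, Matrix.of_apply]
  rw [integral_finsetSum _ fun x _ => integrable_finsetSum _ fun y _ => (hF x y).mul_const _]
  refine Finset.sum_congr rfl fun x _ => ?_
  rw [integral_finsetSum _ fun y _ => (hF x y).mul_const _]
  exact Finset.sum_congr rfl fun y _ => integral_mul_const _ _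

section Moments

variable {n : ℕ} {Θ : Type*} [MeasurableSpace Θ] [TopologicalSpace Θ] [OpensMeasurableSpace Θ]
  (ν : Measure Θ) [IsFiniteMeasure ν] {U : Θ → Op n}

theorem integral_loss_eq_firstMoment (hU : Continuous U)
    (hu : ∀ θ, U θ ∈ Matrix.unitaryGroup (Fin n → Fin 2) ℂ) (ρ O : Op n) :
    ∫ θ, loss (U θ) ρ O ∂ν = (firstMoment ν U ρ * O).trace := by
  refine integral_trace_mul ν (fun x y => ?_) O
  refine integrable_comp_unitary ν hU hu (f := fun M => (M * ρ * Mᴴ) x y) ?_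
  exact ((continuous_id.matrix_mul continuous_const).matrix_mul
    continuous_id.matrix_conjTranspose).matrix_elem x y

/-- The identity $(\mathrm{Tr}M)^2=\mathrm{Tr}[M\otimes M]$ makes the squared loss linear in the
integrand of the second moment. -/
theorem loss_sq_eq (V ρ O : Op n) :
    loss V ρ O ^ 2 = ((V ⊗ₖ V) * (ρ ⊗ₖ ρ) * (V ⊗ₖ V)ᴴ * (O ⊗ₖ O)).trace := by
  rw [conjTranspose_kronecker, ← mul_kronecker_mul, ← mul_kronecker_mul, ← mul_kronecker_mul,
    trace_kronecker, sq, loss]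

theorem integral_loss_sq_eq_secondMoment (hU : Continuous U)
    (hu : ∀ θ, U θ ∈ Matrix.unitaryGroup (Fin n → Fin 2) ℂ) (ρ O : Op n) :
    ∫ θ, loss (U θ) ρ O ^ 2 ∂ν = (secondMoment ν U (ρ ⊗ₖ ρ) * (O ⊗ₖ O)).trace := by
  simp only [loss_sq_eq]
  refine integral_trace_mul ν (fun x y => ?_) (O ⊗ₖ O)
  refine integrable_comp_unitary ν hU hu
    (f := fun M => ((M ⊗ₖ M) * (ρ ⊗ₖ ρ) * (M ⊗ₖ M)ᴴ) x y) ?_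
  have hk : Continuous fun M : Op n => M ⊗ₖ M :=
    continuous_matrix fun i j => (continuous_id.matrix_elem _ _).mul (continuous_id.matrix_elem _ _)
  exact ((hk.matrix_mul continuous_const).matrix_mul hk.matrix_conjTranspose).matrix_elem x y

theorem IsTwoDesign.lossVariance_eq {μ : Measure (group n)} [IsFiniteMeasure μ]
    (h : IsTwoDesign ν U μ) (hU : Continuous U)
    (hu : ∀ θ, U θ ∈ Matrix.unitaryGroup (Fin n → Fin 2) ℂ) (ρ O : Op n) :
    lossVariance ν U ρ O = lossVariance μ groupOp ρ O := by
  rw [lossVariance, lossVariance, integral_loss_eq_firstMoment ν hU hu,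
    integral_loss_sq_eq_secondMoment ν hU hu,
    integral_loss_eq_firstMoment μ (continuous_groupOp n) groupOp_mem_unitaryGroup,
    integral_loss_sq_eq_secondMoment μ (continuous_groupOp n) groupOp_mem_unitaryGroup,
    h.first, h.second]

end Moments

end Matchgate

/-- Part one: the purity of a fermionic state. Part two: the variance of the loss, over the group
`G` with its normalized Haar measure `μ`, and for every parametrized circuit that is a 2-design
over `G`. For `n = 2` the observable has to be a Pauli operator. -/
theorem mainTheorem9 (n : ℕ) (ρ : Matchgate.Op n) (hρ : Matchgate.IsFermionicState ρ) :
    (Matchgate.gPurity ρ = Matchgate.kappaPurity 2 ρ ∧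
      Matchgate.gPurity ρ =
        (2 * (Matchgate.extDensity ρ * Matchgate.extDensity ρ).trace - (n : ℂ)) / 2 ^ n ∧
      Matchgate.gPurity ρ = ((n : ℂ) - Matchgate.linEntropy ρ) / 2 ^ n) ∧
    (2 ≤ n →
      ∀ O : Matchgate.Op n, (∃ A ∈ Matchgate.dla n, O = Complex.I • A) →
        (O * O).trace = 2 ^ n → (n = 2 → Matchgate.IsPauli O) →
      ∀ (μ : MeasureTheory.Measure (Matchgate.group n)) [μ.IsHaarMeasure]
        [MeasureTheory.IsProbabilityMeasure μ],
        Matchgate.lossVariance μ Matchgate.groupOp ρ O =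
          ((n : ℂ) - Matchgate.linEntropy ρ) / (Module.finrank ℝ (Matchgate.dla n) : ℂ) ∧
        ∀ (L : ℕ) (H : Fin L → Matchgate.Op n), (∀ l, H l ∈ Matchgate.generators n) →
          ∀ (ν : MeasureTheory.Measure (Fin L → ℝ)) [MeasureTheory.IsProbabilityMeasure ν],
            Matchgate.IsTwoDesign ν (Matchgate.circuit H) μ →
            Matchgate.lossVariance ν (Matchgate.circuit H) ρ O =
              ((n : ℂ) - Matchgate.linEntropy ρ) /
                (Module.finrank ℝ (Matchgate.dla n) : ℂ)) := by
  have hherm : ρᴴ = ρ := hρ.posSemidef.isHermitian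
  have htr : ρ.trace = 1 := hρ.trace_eq_one
  have hpur : Matchgate.gPurity ρ =
      (2 * (Matchgate.extDensity ρ * Matchgate.extDensity ρ).trace - (n : ℂ)) / 2 ^ n := by
    rw [Matchgate.gPurity_eq hherm, Matchgate.trace_extDensity_sq htr]
    ring
  refine ⟨⟨Matchgate.gPurity_eq_kappaPurity_two ρ, hpur, ?_⟩, ?_⟩
  · rw [Matchgate.sub_linEntropy htr, hpur]
  · rintro hn _ ⟨A, hA, rfl⟩ hO hP μ _ _
    have hvar := Matchgate.lossVariance_group μ hn htr hA hO hP
    refine ⟨hvar, fun L H hH ν _ hdesign => ?_⟩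
    rw [← hvar]
    exact hdesign.lossVariance_eq ν (Matchgate.continuous_circuit H)
      (Matchgate.circuit_mem_unitaryGroup hH) ρ _
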